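/- **Setting.** Let $n\in\mathbb N$, $a<b$, $a_i<b_i$ ($1\le i\le n$), $\Omega=\prod_{i=1}^n[a_i,b_i]$, $P=[a,b]\times\Omega$. For an order $\alpha(\cdot,\cdot)$ with values in $(0,1)$ and a real function $f$, let $${}_cI_t^{1-\alpha}f(t)=\int_c^t\frac{(t-\tau)^{-\alpha(t,\tau)}}{\Gamma(1-\alpha(t,\tau))}f(\tau)\,d\tau,\qquad {}_tI_d^{1-\alpha}f(t)=\int_t^d\frac{(\tau-t)^{-\alpha(\tau,t)}}{\Gamma(1-\alpha(\tau,t))}f(\tau)\,d\tau .$$ The left and right Riemann–Liouville derivatives are ${}_cD_t^{\alpha}f=\frac{d}{dt}\,{}_cI_t^{1-\alpha}f$ and ${}_tD_d^{\alpha}f=-\frac{d}{dt}\,{}_tI_d^{1-\alpha}f$ (one-sided at end points of the interval considered). The left and right Caputo derivatives are ${}_c^CD_t^{\alpha}f={}_cI_t^{1-\alpha}f'$ and ${}_t^CD_d^{\alpha}f=-{}_tI_d^{1-\alpha}f'$. For $\gamma=(\gamma_1,\gamma_2)\in[0,1]^2$, the combined Caputo derivative on $[c,d]$ is ${}^CD_\gamma^{\alpha,\beta}f=\gamma_1\,{}_c^CD_t^{\alpha}f+\gamma_2\,{}_t^CD_d^{\beta}f$,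 and the dual derivative on $[c,d]$ is $D_{\overline\gamma}^{\beta,\alpha}f=\gamma_2\,{}_cD_t^{\beta}f+\gamma_1\,{}_tD_d^{\alpha}f$. A term with weight $0$ is absent. Let $\alpha,\beta:[a,b]^2\to(0,1)$ and $\alpha_i,\beta_i:[a_i,b_i]^2\to(0,1)$ be measurable, and let $\gamma,\gamma^1,\dots,\gamma^n\in[0,1]^2$. Assume that for every $y\in C^1(P)$ the combined Caputo derivatives ${}^CD_{\gamma}^{\alpha,\beta}y$ (in $t$, on $[a,b]$) and ${}^CD_{\gamma^i}^{\alpha_i,\beta_i}y$ (in $s_i$, on $[a_i,b_i]$) exist and are continuous on $P$. Let $L:P\times\mathbb R^{n+3}\to\mathbb R$, $L=L(t,s,x,v,w_1,\dots,w_n,z)$, be of class $C^1$; let $g:\partial P\to\mathbb R$ and $z_a\in\mathbb R$ be given. Write $$[x,z](t,s)=\bigl(t,s,x(t,s),{}^CD_\gamma^{\alpha,\beta}x(t,s),{}^CD_{\gamma^1}^{\alpha_1,\beta_1}x(t,s),\dots,{}^CD_{\gamma^n}^{\alpha_n,\beta_n}x(t,s),z(t)\bigr).$$ A triple $(x,z,T)$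 is admissible if $x\in C^1(P)$, $x=g$ on $\partial P$, $T\in[a,b]$, and $z$ satisfies $z(a)=z_a$ and $$\dot z(t)=\int_\Omega L[x,z](t,s)\,d^ns,\qquad t\in[a,b].$$ It is an extremizer if, for some $\delta>0$, $z(T)$ is the minimum, or the maximum, of $z'(T')$ over all admissible $(x',z',T')$ such that $|T'-T|<\delta$ and such that, everywhere on $P$, $x'$ and each of its combined Caputo derivatives in $t,s_1,\dots,s_n$ differ from those of $x$ by less than $\delta$. Let $(x,z,T)$ be an extremizer with $T>a$, and put $$\lambda(t)=\exp\Bigl(-\int_a^t\int_\Omega\partial_zL[x,z](\tau,s)\,d^ns\,d\tau\Bigr),\quad f=\lambda\,\partial_vL[x,z],\quad f_i=\lambda\,\partial_{w_i}L[x,z].$$ Assume that the following exist and are continuous: $D_{\overline\gamma}^{\beta,\alpha}f$ (in $t$, on $[a,T]$) and $D_{\overline\gamma^i}^{\beta_i,\alpha_i}f_i$ (in $s_i$, on $[a_i,b_i]$), $i=1,\dots,n$, on $[a,T]\times\Omega$; and, if $\gamma_2\ne0$, ${}_aD_t^{\beta}f$ on $[a,b]\times\Omega$ and ${}_TD_t^{\beta}f$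 on $[T,b]\times\Omega$. **Theorem.** Under these assumptions: 1. for all $(t,s)\in[a,T]\times\Omega$, $$\lambda(t)\,\partial_xL[x,z](t,s)+D_{\overline\gamma}^{\beta,\alpha}f(t,s)+\sum_{i=1}^nD_{\overline\gamma^i}^{\beta_i,\alpha_i}f_i(t,s)=0;$$ 2. if $T<b$, then for all $(t,s)\in[T,b]\times\Omega$, $$\gamma_2\bigl({}_aD_t^{\beta}f(t,s)-{}_TD_t^{\beta}f(t,s)\bigr)=0;$$ 3. for all $s\in\Omega$, $$\bigl[\gamma_1\,{}_tI_T^{1-\alpha}f(t,s)-\gamma_2\,{}_TI_t^{1-\beta}f(t,s)\bigr]_{t=T}=0;$$ 4. if $T<b$, then $\displaystyle\int_\Omega L[x,z](T,s)\,d^ns=0$. -/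

import Mathlib

open Set MeasureTheory

noncomputable section

namespace Herglotz

/-! ### Variable-order fractional operators of functions of one real variable -/

/-- Integrand of the left Riemann-Liouville integral of order `α(·,·)`. -/
def leftKernel (α : ℝ → ℝ → ℝ) (f : ℝ → ℝ) (t τ : ℝ) : ℝ :=
  1 / Real.Gamma (α t τ) * (t - τ) ^ (α t τ - 1) * f τ

/-- Integrand of the right Riemann-Liouville integral of order `α(·,·)`. -/
def rightKernel (α : ℝ → ℝ → ℝ) (f : ℝ → ℝ) (t τ : ℝ) : ℝ :=
  1 / Real.Gamma (α τ t) * (τ - t) ^ (α τ t - 1) * f τ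

/-- Left Riemann-Liouville integral with base point `c`. -/
def leftInt (α : ℝ → ℝ → ℝ) (c : ℝ) (f : ℝ → ℝ) (t : ℝ) : ℝ :=
  ∫ τ in c..t, leftKernel α f t τ

/-- Right Riemann-Liouville integral with base point `d`. -/
def rightInt (α : ℝ → ℝ → ℝ) (d : ℝ) (f : ℝ → ℝ) (t : ℝ) : ℝ :=
  ∫ τ in t..d, rightKernel α f t τ

def LeftIntExists (α : ℝ → ℝ → ℝ) (c : ℝ) (f : ℝ → ℝ) (t : ℝ) : Prop :=
  IntervalIntegrable (leftKernel α f t) volume c t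

def RightIntExists (α : ℝ → ℝ → ℝ) (d : ℝ) (f : ℝ → ℝ) (t : ℝ) : Prop :=
  IntervalIntegrable (rightKernel α f t) volume t d

/-- The order `1 - α(·,·)`. -/
def compl (α : ℝ → ℝ → ℝ) : ℝ → ℝ → ℝ := fun t τ => 1 - α t τ

/-- Left Caputo derivative: the kernel is `(t - τ) ^ (-α(t,τ)) / Γ(1 - α(t,τ))`. The derivative of
`f` is only used at interior points of the interval on which `f` is considered (up to a null set). -/
def leftCaputo (α : ℝ → ℝ → ℝ) (c : ℝ) (f : ℝ → ℝ) (t : ℝ) : ℝ :=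
  leftInt (compl α) c (deriv f) t

/-- Right Caputo derivative. -/
def rightCaputo (α : ℝ → ℝ → ℝ) (d : ℝ) (f : ℝ → ℝ) (t : ℝ) : ℝ :=
  -rightInt (compl α) d (deriv f) t

/-- Combined Caputo derivative on `[c, d]`. -/
def combinedCaputo (α β : ℝ → ℝ → ℝ) (γ : ℝ × ℝ) (c d : ℝ) (f : ℝ → ℝ) (t : ℝ) : ℝ :=
  γ.1 * leftCaputo α c f t + γ.2 * rightCaputo β d f t

/-- The defining integrals converge (a term with coefficient zero is absent). -/
def CombinedCaputoExists (α β : ℝ → ℝ → ℝ) (γ : ℝ × ℝ) (c d : ℝ) (f : ℝ → ℝ) (t : ℝ) : Prop :=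
  (γ.1 ≠ 0 → LeftIntExists (compl α) c (deriv f) t) ∧
  (γ.2 ≠ 0 → RightIntExists (compl β) d (deriv f) t)

/-- Left Riemann-Liouville derivative on `[c, d]`, one-sided at the end points. -/
def leftRL (α : ℝ → ℝ → ℝ) (c d : ℝ) (f : ℝ → ℝ) (t : ℝ) : ℝ :=
  derivWithin (leftInt (compl α) c f) (Icc c d) t

/-- Right Riemann-Liouville derivative on `[c, d]`, one-sided at the end points. -/
def rightRL (α : ℝ → ℝ → ℝ) (c d : ℝ) (f : ℝ → ℝ) (t : ℝ) : ℝ :=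
  derivWithin (fun r => -rightInt (compl α) d f r) (Icc c d) t

/-- The left Riemann-Liouville derivative of `f` exists on all of `[c, d]`. -/
def LeftRLExists (α : ℝ → ℝ → ℝ) (c d : ℝ) (f : ℝ → ℝ) : Prop :=
  (∀ t ∈ Icc c d, LeftIntExists (compl α) c f t) ∧
  DifferentiableOn ℝ (leftInt (compl α) c f) (Icc c d)

/-- The right Riemann-Liouville derivative of `f` exists on all of `[c, d]`. -/
def RightRLExists (α : ℝ → ℝ → ℝ) (c d : ℝ) (f : ℝ → ℝ) : Prop :=
  (∀ t ∈ Icc c d, RightIntExists (compl α) d f t) ∧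
  DifferentiableOn ℝ (fun r => -rightInt (compl α) d f r) (Icc c d)

/-- The dual combined Riemann-Liouville derivative on `[c, d]`, with orders `β, α` and weights
`(γ₂, γ₁)`: the left derivative of order `β` has weight `γ₂`, the right one of order `α` has
weight `γ₁`. -/
def dualRL (β α : ℝ → ℝ → ℝ) (γ : ℝ × ℝ) (c d : ℝ) (f : ℝ → ℝ) (t : ℝ) : ℝ :=
  γ.2 * leftRL β c d f t + γ.1 * rightRL α c d f t

/-! ### Partial derivatives of a Lagrangian `L(t, s, x, v, w₁, …, wₙ, z)` -/

/-- Arguments `(t, s, x, v, w, z)` of a Lagrangian. -/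
abbrev Arg (n : ℕ) := ℝ × (Fin n → ℝ) × ℝ × ℝ × (Fin n → ℝ) × ℝ

/-- Partial derivative in `x` (argument number `n + 2`). -/
def partialX {n : ℕ} (L : Arg n → ℝ) : Arg n → ℝ
  | (t, s, x, v, w, z) => deriv (fun u => L (t, s, u, v, w, z)) x

/-- Partial derivative in `v` (argument number `n + 3`). -/
def partialV {n : ℕ} (L : Arg n → ℝ) : Arg n → ℝ
  | (t, s, x, v, w, z) => deriv (fun u => L (t, s, x, u, w, z)) v

/-- Partial derivative in `wᵢ` (argument number `n + 3 + i`). -/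
def partialW {n : ℕ} (L : Arg n → ℝ) (i : Fin n) : Arg n → ℝ
  | (t, s, x, v, w, z) => deriv (fun u => L (t, s, x, v, Function.update w i u, z)) (w i)

/-- Partial derivative in `z` (argument number `2 n + 4`). -/
def partialZ {n : ℕ} (L : Arg n → ℝ) : Arg n → ℝ
  | (t, s, x, v, w, z) => deriv (fun u => L (t, s, x, v, w, u)) z

/-! ### The variational problem -/

/-- The data of the problem: the interval `[a, b]`, the box `Ω = ∏ᵢ [loᵢ, hiᵢ]`, the orders and
weights of the fractional derivatives in `t` and in each `sᵢ`, the Lagrangian, the boundary values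
of `x` and the initial value of `z`. -/
structure Data (n : ℕ) where
  a : ℝ
  b : ℝ
  lo : Fin n → ℝ
  hi : Fin n → ℝ
  α : ℝ → ℝ → ℝ
  β : ℝ → ℝ → ℝ
  γ : ℝ × ℝ
  αs : Fin n → ℝ → ℝ → ℝ
  βs : Fin n → ℝ → ℝ → ℝ
  γs : Fin n → ℝ × ℝ
  L : Arg n → ℝ
  g : ℝ × (Fin n → ℝ) → ℝ
  za : ℝ

namespace Data

variable {n : ℕ} (D : Data n)

/-- The box `Ω`. -/
def Ω : Set (Fin n → ℝ) := Icc D.lo D.hi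

/-- `P = [a, b] × Ω`. -/
def P : Set (ℝ × (Fin n → ℝ)) := Icc D.a D.b ×ˢ D.Ω

/-- The combined Caputo derivative of `x` in the variable `t`. -/
def capT (x : ℝ × (Fin n → ℝ) → ℝ) (p : ℝ × (Fin n → ℝ)) : ℝ :=
  combinedCaputo D.α D.β D.γ D.a D.b (fun τ => x (τ, p.2)) p.1

/-- The combined Caputo derivative of `x` in the variable `sᵢ`. -/
def capS (i : Fin n) (x : ℝ × (Fin n → ℝ) → ℝ) (p : ℝ × (Fin n → ℝ)) : ℝ :=
  combinedCaputo (D.αs i) (D.βs i) (D.γs i) (D.lo i) (D.hi i)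
    (fun σ => x (p.1, Function.update p.2 i σ)) (p.2 i)

/-- The argument list `[x, z](t, s)` at which the Lagrangian is evaluated. -/
def arg (x : ℝ × (Fin n → ℝ) → ℝ) (z : ℝ → ℝ) (p : ℝ × (Fin n → ℝ)) : Arg n :=
  (p.1, p.2, x p, D.capT x p, fun i => D.capS i x p, z p.1)

/-- The multiplier `λ(t)`. -/
def mult (x : ℝ × (Fin n → ℝ) → ℝ) (z : ℝ → ℝ) (t : ℝ) : ℝ :=
  Real.exp (-∫ τ in D.a..t, ∫ s in D.Ω, partialZ D.L (D.arg x z (τ, s)))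

/-- `λ(t) ∂L/∂v [x, z](t, s)`. -/
def momT (x : ℝ × (Fin n → ℝ) → ℝ) (z : ℝ → ℝ) (p : ℝ × (Fin n → ℝ)) : ℝ :=
  D.mult x z p.1 * partialV D.L (D.arg x z p)

/-- `λ(t) ∂L/∂wᵢ [x, z](t, s)`. -/
def momS (i : Fin n) (x : ℝ × (Fin n → ℝ) → ℝ) (z : ℝ → ℝ) (p : ℝ × (Fin n → ℝ)) : ℝ :=
  D.mult x z p.1 * partialW D.L i (D.arg x z p)

/-- Left Riemann-Liouville derivative in `t`, with base point `c`, of `λ ∂L/∂v [x, z]`. -/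
def leftMomT (c : ℝ) (x : ℝ × (Fin n → ℝ) → ℝ) (z : ℝ → ℝ) (p : ℝ × (Fin n → ℝ)) : ℝ :=
  leftRL D.β c D.b (fun τ => D.momT x z (τ, p.2)) p.1

/-- Dual combined derivative in `t`, on `[a, T]`, of `λ ∂L/∂v [x, z]`. -/
def dualMomT (T : ℝ) (x : ℝ × (Fin n → ℝ) → ℝ) (z : ℝ → ℝ) (p : ℝ × (Fin n → ℝ)) : ℝ :=
  dualRL D.β D.α D.γ D.a T (fun τ => D.momT x z (τ, p.2)) p.1

/-- Dual combined derivative in `sᵢ` of `λ ∂L/∂wᵢ [x, z]`. -/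
def dualMomS (i : Fin n) (x : ℝ × (Fin n → ℝ) → ℝ) (z : ℝ → ℝ) (p : ℝ × (Fin n → ℝ)) : ℝ :=
  dualRL (D.βs i) (D.αs i) (D.γs i) (D.lo i) (D.hi i)
    (fun σ => D.momS i x z (p.1, Function.update p.2 i σ)) (p.2 i)

/-- Standing assumptions on the data. -/
structure Standing : Prop where
  a_lt_b : D.a < D.b
  lo_lt_hi : ∀ i, D.lo i < D.hi i
  α_meas : Measurable (Function.uncurry D.α)
  β_meas : Measurable (Function.uncurry D.β)
  αs_meas : ∀ i, Measurable (Function.uncurry (D.αs i))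
  βs_meas : ∀ i, Measurable (Function.uncurry (D.βs i))
  α_mem : ∀ t ∈ Icc D.a D.b, ∀ τ ∈ Icc D.a D.b, D.α t τ ∈ Ioo (0 : ℝ) 1
  β_mem : ∀ t ∈ Icc D.a D.b, ∀ τ ∈ Icc D.a D.b, D.β t τ ∈ Ioo (0 : ℝ) 1
  αs_mem : ∀ i, ∀ t ∈ Icc (D.lo i) (D.hi i), ∀ τ ∈ Icc (D.lo i) (D.hi i),
    D.αs i t τ ∈ Ioo (0 : ℝ) 1
  βs_mem : ∀ i, ∀ t ∈ Icc (D.lo i) (D.hi i), ∀ τ ∈ Icc (D.lo i) (D.hi i),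
    D.βs i t τ ∈ Ioo (0 : ℝ) 1
  γ_mem : D.γ.1 ∈ Icc (0 : ℝ) 1 ∧ D.γ.2 ∈ Icc (0 : ℝ) 1
  γs_mem : ∀ i, (D.γs i).1 ∈ Icc (0 : ℝ) 1 ∧ (D.γs i).2 ∈ Icc (0 : ℝ) 1
  L_contDiff : ContDiffOn ℝ 1 D.L {q | (q.1, q.2.1) ∈ D.P}
  /-- Caputo derivatives in `t` of trajectories of class `C¹(P)` exist and are continuous. -/
  capT_cont : ∀ y : ℝ × (Fin n → ℝ) → ℝ, ContDiffOn ℝ 1 y D.P →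
    (∀ p ∈ D.P, CombinedCaputoExists D.α D.β D.γ D.a D.b (fun τ => y (τ, p.2)) p.1) ∧
    ContinuousOn (D.capT y) D.P
  /-- Caputo derivatives in `sᵢ` of trajectories of class `C¹(P)` exist and are continuous. -/
  capS_cont : ∀ i, ∀ y : ℝ × (Fin n → ℝ) → ℝ, ContDiffOn ℝ 1 y D.P →
    (∀ p ∈ D.P, CombinedCaputoExists (D.αs i) (D.βs i) (D.γs i) (D.lo i) (D.hi i)
      (fun σ => y (p.1, Function.update p.2 i σ)) (p.2 i)) ∧
    ContinuousOn (D.capS i y) D.P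

/-- `(x, z, T)` is admissible: `x` is of class `C¹(P)` with the prescribed boundary values, `z`
solves the Herglotz differential equation of `x` on `[a, b]` with the prescribed initial value, and
`T ∈ [a, b]`. -/
structure Admissible (x : ℝ × (Fin n → ℝ) → ℝ) (z : ℝ → ℝ) (T : ℝ) : Prop where
  contDiff : ContDiffOn ℝ 1 x D.P
  boundary : ∀ p ∈ frontier D.P, x p = D.g p
  initial : z D.a = D.za
  ode : ∀ t ∈ Icc D.a D.b,
    HasDerivWithinAt z (∫ s in D.Ω, D.L (D.arg x z (t, s))) (Icc D.a D.b) t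
  mem : T ∈ Icc D.a D.b

/-- `(x', T')` is within `δ` of `(x, T)`: uniform distance of the functions and of all their
combined Caputo derivatives, and distance of the terminal times. -/
def Near (δ : ℝ) (x : ℝ × (Fin n → ℝ) → ℝ) (T : ℝ) (x' : ℝ × (Fin n → ℝ) → ℝ) (T' : ℝ) : Prop :=
  |T' - T| < δ ∧ ∀ p ∈ D.P, |x' p - x p| < δ ∧ |D.capT x' p - D.capT x p| < δ ∧
    ∀ i, |D.capS i x' p - D.capS i x p| < δ

/-- `(x, T)`, with its `z`, is a local minimizer or a local maximizer of the terminal value `z(T)`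
among admissible triples. -/
def IsExtremizer (x : ℝ × (Fin n → ℝ) → ℝ) (z : ℝ → ℝ) (T : ℝ) : Prop :=
  D.Admissible x z T ∧ ∃ δ > 0,
    (∀ x' z' T', D.Admissible x' z' T' → D.Near δ x T x' T' → z T ≤ z' T') ∨
    (∀ x' z' T', D.Admissible x' z' T' → D.Near δ x T x' T' → z' T' ≤ z T)

/-- The Riemann-Liouville derivatives that occur in the Euler-Lagrange equations exist and are
continuous (those multiplied by a weight that is zero do not occur). -/
structure Regular (x : ℝ × (Fin n → ℝ) → ℝ) (z : ℝ → ℝ) (T : ℝ) : Prop where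
  left : D.γ.2 ≠ 0 →
    (∀ s ∈ D.Ω, LeftRLExists D.β D.a D.b (fun τ => D.momT x z (τ, s))) ∧
    ContinuousOn (D.leftMomT D.a x z) D.P
  left_T : D.γ.2 ≠ 0 →
    (∀ s ∈ D.Ω, LeftRLExists D.β T D.b (fun τ => D.momT x z (τ, s))) ∧
    ContinuousOn (D.leftMomT T x z) (Icc T D.b ×ˢ D.Ω)
  right : D.γ.1 ≠ 0 →
    ∀ s ∈ D.Ω, RightRLExists D.α D.a T (fun τ => D.momT x z (τ, s))
  dual : ContinuousOn (D.dualMomT T x z) (Icc D.a T ×ˢ D.Ω)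
  leftS : ∀ i, (D.γs i).2 ≠ 0 → ∀ p ∈ Icc D.a T ×ˢ D.Ω,
    LeftRLExists (D.βs i) (D.lo i) (D.hi i)
      (fun σ => D.momS i x z (p.1, Function.update p.2 i σ))
  rightS : ∀ i, (D.γs i).1 ≠ 0 → ∀ p ∈ Icc D.a T ×ˢ D.Ω,
    RightRLExists (D.αs i) (D.lo i) (D.hi i)
      (fun σ => D.momS i x z (p.1, Function.update p.2 i σ))
  dualS : ∀ i, ContinuousOn (D.dualMomS i x z) (Icc D.a T ×ˢ D.Ω)

end Data

end Herglotz

end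

/-! Perturb `x` to `x + ε h`, with `h` of class C¹ and zero on the boundary of `P`, and keep `T`
fixed. The Herglotz equation still has a solution `w ε` with the same initial value on all of `[a,
b]` for small `ε` (`exists_perturbed_solutions`). The multiplier `λ` solves the adjoint of the
equation linearized in `z`, so the derivative of `λ(T) w ε T` at `ε = 0` is the integral over `[a,
T] × Ω` of `λ` times the derivative of `L` along `h` and its Caputo derivatives
(`hasDerivAt_perturbed_solutions`). Extremality and `λ(T) > 0` make it vanish
(`Data.Standing.first_variation`).

To free `h` from the fractional derivatives, write the combined Caputo derivative as an integral
operator applied to `h'`. Fubini moves the kernel onto the momentum `f`; the transposed integral is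
differentiable with derivative minus the dual derivative, and an ordinary integration by parts
finishes (`integral_mul_combKernel_deriv`). Fubini needs a bound on the L¹ norm of the kernel
uniform in `t`. The orders may come arbitrarily close to `1`, so this is not automatic; it follows
by Banach–Steinhaus from the assumption that every C¹ function has continuous Caputo derivatives
(`exists_bound_combKernel`).

Variations supported in `[a, T]` yield the Euler–Lagrange equation. Variations supported in `[T, b]`
still influence `z(T)`, because the right Caputo derivative at a time before `T` sees the future;
they yield the second condition (`integral_mul_combKernel_deriv_tail`). The third condition involves
only integrals over an interval of length zero. The fourth is `z'(T) = 0`, obtained by moving `T`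
alone. -/

namespace Herglotz

/-! ### Riemann–Liouville integrals as integral operators on a fixed interval. -/

/-- Kernel of the left Riemann-Liouville integral of order `1 - α`, extended by zero off the
triangle `τ < t`. The transposed kernel is that of the right integral. -/
noncomputable def triKernel (α : ℝ → ℝ → ℝ) (t τ : ℝ) : ℝ :=
  if τ < t then 1 / Real.Gamma (compl α t τ) * (t - τ) ^ (compl α t τ - 1) else 0

/-- The reciprocal of Gamma is entire, hence continuous, poles of Gamma included. This matters
because the orders are unconstrained outside the square. -/
theorem measurable_one_div_Gamma : Measurable fun x : ℝ => 1 / Real.Gamma x := by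
  have h : Continuous fun x : ℝ => ((Complex.Gamma (x : ℂ))⁻¹).re :=
    Complex.continuous_re.comp
      (Complex.differentiable_one_div_Gamma.continuous.comp Complex.continuous_ofReal)
  convert h.measurable using 2 with x
  rw [Complex.Gamma_ofReal, ← Complex.ofReal_inv, Complex.ofReal_re, one_div]

theorem measurable_triKernel {α : ℝ → ℝ → ℝ} (hα : Measurable (Function.uncurry α)) :
    Measurable (Function.uncurry (triKernel α)) := by
  have hc : Measurable fun q : ℝ × ℝ => compl α q.1 q.2 := measurable_const.sub hα
  exact Measurable.ite (measurableSet_lt measurable_snd measurable_fst)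
    ((measurable_one_div_Gamma.comp hc).mul
      ((measurable_fst.sub measurable_snd).pow (hc.sub_const 1))) measurable_const

theorem triKernel_nonneg {α : ℝ → ℝ → ℝ} {t τ : ℝ} (h : α t τ ∈ Ioo (0 : ℝ) 1) :
    0 ≤ triKernel α t τ := by
  unfold triKernel
  split_ifs with hlt
  · have : 0 < compl α t τ := sub_pos.2 h.2
    have := Real.Gamma_pos_of_pos this
    have := Real.rpow_nonneg (sub_pos.2 hlt).le (compl α t τ - 1)
    positivity
  · exact le_rfl

theorem triKernel_of_le {α : ℝ → ℝ → ℝ} {t τ : ℝ} (h : t ≤ τ) : triKernel α t τ = 0 :=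
  if_neg h.not_gt

theorem triKernel_mul_eq_indicator_left (α : ℝ → ℝ → ℝ) (f : ℝ → ℝ) (t : ℝ) :
    (fun τ => triKernel α t τ * f τ) = (Iio t).indicator (leftKernel (compl α) f t) := by
  ext τ
  by_cases h : τ < t <;> simp [triKernel, leftKernel, h]

theorem triKernel_mul_eq_indicator_right (α : ℝ → ℝ → ℝ) (f : ℝ → ℝ) (t : ℝ) :
    (fun τ => triKernel α τ t * f τ) = (Ioi t).indicator (rightKernel (compl α) f t) := by
  ext τ
  by_cases h : t < τ <;> simp [triKernel, rightKernel, h]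

theorem Icc_inter_Iio_of_mem {c d t : ℝ} (ht : t ∈ Icc c d) : Icc c d ∩ Iio t = Ico c t := by
  ext x
  simp only [mem_inter_iff, mem_Icc, mem_Iio, mem_Ico]
  exact ⟨fun h => ⟨h.1.1, h.2⟩, fun h => ⟨⟨h.1, h.2.le.trans ht.2⟩, h.2⟩⟩

theorem Icc_inter_Ioi_of_mem {c d t : ℝ} (ht : t ∈ Icc c d) : Icc c d ∩ Ioi t = Ioc t d := by
  ext x
  simp only [mem_inter_iff, mem_Icc, mem_Ioi, mem_Ioc]
  exact ⟨fun h => ⟨h.2, h.1.2⟩, fun h => ⟨⟨ht.1.trans h.1.le, h.2⟩, h.1⟩⟩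

theorem leftInt_eq {α : ℝ → ℝ → ℝ} {c d t : ℝ} (f : ℝ → ℝ) (ht : t ∈ Icc c d) :
    leftInt (compl α) c f t = ∫ τ in Icc c d, triKernel α t τ * f τ := by
  rw [triKernel_mul_eq_indicator_left, setIntegral_indicator measurableSet_Iio,
    Icc_inter_Iio_of_mem ht, leftInt, intervalIntegral.integral_of_le ht.1,
    integral_Ioc_eq_integral_Ioo, integral_Ico_eq_integral_Ioo]

theorem rightInt_eq {α : ℝ → ℝ → ℝ} {c d t : ℝ} (f : ℝ → ℝ) (ht : t ∈ Icc c d) :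
    rightInt (compl α) d f t = ∫ τ in Icc c d, triKernel α τ t * f τ := by
  rw [triKernel_mul_eq_indicator_right, setIntegral_indicator measurableSet_Ioi,
    Icc_inter_Ioi_of_mem ht, rightInt, intervalIntegral.integral_of_le ht.2]

theorem LeftIntExists.integrableOn {α : ℝ → ℝ → ℝ} {c d t : ℝ} {f : ℝ → ℝ}
    (h : LeftIntExists (compl α) c f t) (ht : t ∈ Icc c d) :
    IntegrableOn (fun τ => triKernel α t τ * f τ) (Icc c d) := by
  rw [triKernel_mul_eq_indicator_left, integrableOn_indicator_iff measurableSet_Iio, inter_comm,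
    Icc_inter_Iio_of_mem ht, integrableOn_Ico_iff_integrableOn_Ioo,
    ← integrableOn_Ioc_iff_integrableOn_Ioo]
  exact (intervalIntegrable_iff_integrableOn_Ioc_of_le ht.1).1 h

theorem RightIntExists.integrableOn {α : ℝ → ℝ → ℝ} {c d t : ℝ} {f : ℝ → ℝ}
    (h : RightIntExists (compl α) d f t) (ht : t ∈ Icc c d) :
    IntegrableOn (fun τ => triKernel α τ t * f τ) (Icc c d) := by
  rw [triKernel_mul_eq_indicator_right, integrableOn_indicator_iff measurableSet_Ioi, inter_comm,
    Icc_inter_Ioi_of_mem ht]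
  exact (intervalIntegrable_iff_integrableOn_Ioc_of_le ht.2).1 h

/-! ### Transposition of kernels and fractional integration by parts. -/

/-- Fubini: slices bounded in L¹ uniformly over a set `A` of finite measure, multiplied by bounded
functions, give an integrable function on `A × B`. -/
theorem integral_mul_integral_swap {m : ℝ → ℝ → ℝ} (hm : Measurable (Function.uncurry m))
    {A B : Set ℝ} (hA : MeasurableSet A) (hB : MeasurableSet B) (hAf : volume A ≠ ⊤)
    {C M N : ℝ} (hN : 0 ≤ N) (hi : ∀ t ∈ A, IntegrableOn (m t) B)
    (hb : ∀ t ∈ A, ∫ τ in B, |m t τ| ≤ C) {f g : ℝ → ℝ}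
    (hf : AEStronglyMeasurable f (volume.restrict A)) (hfM : ∀ t ∈ A, |f t| ≤ M)
    (hg : AEStronglyMeasurable g (volume.restrict B)) (hgN : ∀ t ∈ B, |g t| ≤ N) :
    ∫ t in A, f t * ∫ τ in B, m t τ * g τ = ∫ τ in B, g τ * ∫ t in A, m t τ * f t := by
  have : IsFiniteMeasure (volume.restrict A) := ⟨by simpa using hAf.lt_top⟩
  have hmeas : AEStronglyMeasurable (fun q : ℝ × ℝ => f q.1 * (m q.1 q.2 * g q.2))
      ((volume.restrict A).prod (volume.restrict B)) :=
    hf.comp_fst.mul (hm.aestronglyMeasurable.mul hg.comp_snd)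
  have hint : ∀ t ∈ A, IntegrableOn (fun τ => f t * (m t τ * g τ)) B := fun t ht =>
    ((hi t ht).mul_bdd (c := N) hg (by
      filter_upwards [ae_restrict_mem hB] with τ hτ using hgN τ hτ)).const_mul _
  have hI : Integrable (Function.uncurry fun t τ => f t * (m t τ * g τ))
      ((volume.restrict A).prod (volume.restrict B)) := by
    refine (integrable_prod_iff hmeas).2 ⟨?_, ?_⟩
    · filter_upwards [ae_restrict_mem hA] with t ht using hint t ht
    · refine Integrable.of_bound hmeas.norm.integral_prod_right' (M * (N * C)) ?_
      filter_upwards [ae_restrict_mem hA] with t ht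
      have hM : 0 ≤ M := (abs_nonneg _).trans (hfM t ht)
      rw [Real.norm_of_nonneg (integral_nonneg fun _ => norm_nonneg _)]
      calc ∫ τ in B, ‖f t * (m t τ * g τ)‖ ≤ ∫ τ in B, M * (N * |m t τ|) := by
            refine setIntegral_mono_on (hint t ht).norm
              (((hi t ht).abs.const_mul N).const_mul M) hB ?_
            intro τ hτ
            rw [norm_mul, norm_mul, mul_comm ‖m t τ‖]
            gcongr
            · exact hfM t ht
            · exact hgN τ hτ
            · exact le_rfl
        _ = M * (N * ∫ τ in B, |m t τ|) := by rw [integral_const_mul, integral_const_mul]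
        _ ≤ M * (N * C) := by
            have := hb t ht
            gcongr
  calc ∫ t in A, f t * ∫ τ in B, m t τ * g τ = ∫ t in A, ∫ τ in B, f t * (m t τ * g τ) := by
        simp_rw [integral_const_mul]
    _ = ∫ τ in B, ∫ t in A, f t * (m t τ * g τ) := integral_integral_swap hI
    _ = ∫ τ in B, g τ * ∫ t in A, m t τ * f t := by
        simp_rw [← integral_const_mul]
        congr with τ
        congr with t
        ring

/-- Kernel of the operator `f' ↦ γ₁ ᶜD^α f + γ₂ ᶜD^β f`. -/
noncomputable def combKernel (α β : ℝ → ℝ → ℝ) (γ : ℝ × ℝ) (t τ : ℝ) : ℝ :=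
  γ.1 * triKernel α t τ - γ.2 * triKernel β τ t

theorem measurable_combKernel {α β : ℝ → ℝ → ℝ} {γ : ℝ × ℝ}
    (hα : Measurable (Function.uncurry α)) (hβ : Measurable (Function.uncurry β)) :
    Measurable (Function.uncurry (combKernel α β γ)) :=
  ((measurable_triKernel hα).const_mul γ.1).sub
    (((measurable_triKernel hβ).comp measurable_swap).const_mul γ.2)

theorem combKernel_nonneg {α β : ℝ → ℝ → ℝ} {γ : ℝ × ℝ} (hγ : 0 ≤ γ.1) {t τ : ℝ}
    (h : α t τ ∈ Ioo (0 : ℝ) 1) (hlt : τ < t) : 0 ≤ combKernel α β γ t τ := by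
  rw [combKernel, triKernel_of_le hlt.le, mul_zero, sub_zero]
  exact mul_nonneg hγ (triKernel_nonneg h)

theorem combKernel_nonpos {α β : ℝ → ℝ → ℝ} {γ : ℝ × ℝ} (hγ : 0 ≤ γ.2) {t τ : ℝ}
    (h : β τ t ∈ Ioo (0 : ℝ) 1) (hlt : t ≤ τ) : combKernel α β γ t τ ≤ 0 := by
  rw [combKernel, triKernel_of_le hlt, mul_zero, zero_sub, neg_nonpos]
  exact mul_nonneg hγ (triKernel_nonneg h)

theorem combKernel_mul_eq (α β : ℝ → ℝ → ℝ) (γ : ℝ × ℝ) (t τ r : ℝ) :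
    combKernel α β γ t τ * r = γ.1 * (triKernel α t τ * r) - γ.2 * (triKernel β τ t * r) := by
  rw [combKernel]; ring

/-- Handles terms of weight zero, for which no convergence of the defining integral is assumed. -/
theorem _root_.MeasureTheory.IntegrableOn.const_mul_of_ne_zero {X : Type*} [MeasurableSpace X]
    {μ : Measure X} {s : Set X} {f : X → ℝ} {r : ℝ} (h : r ≠ 0 → IntegrableOn f s μ) :
    IntegrableOn (fun x => r * f x) s μ := by
  by_cases hr : r = 0
  · simp [hr]
  · exact (h hr).const_mul r

variable {α β : ℝ → ℝ → ℝ} {γ : ℝ × ℝ} {c d : ℝ}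

theorem CombinedCaputoExists.integrableOn {h : ℝ → ℝ} {t : ℝ} (ht : t ∈ Icc c d)
    (hh : CombinedCaputoExists α β γ c d h t) :
    IntegrableOn (fun τ => combKernel α β γ t τ * deriv h τ) (Icc c d) := by
  simp_rw [combKernel_mul_eq]
  exact (IntegrableOn.const_mul_of_ne_zero fun h1 => (hh.1 h1).integrableOn ht).sub
    (IntegrableOn.const_mul_of_ne_zero fun h1 => (hh.2 h1).integrableOn ht)

theorem combinedCaputo_eq {h : ℝ → ℝ} {t : ℝ} (ht : t ∈ Icc c d)
    (hh : CombinedCaputoExists α β γ c d h t) :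
    combinedCaputo α β γ c d h t = ∫ τ in Icc c d, combKernel α β γ t τ * deriv h τ := by
  simp_rw [combKernel_mul_eq]
  rw [integral_sub
    (IntegrableOn.const_mul_of_ne_zero fun h1 => (hh.1 h1).integrableOn ht)
    (IntegrableOn.const_mul_of_ne_zero fun h1 => (hh.2 h1).integrableOn ht),
    integral_const_mul, integral_const_mul, ← leftInt_eq _ ht, ← rightInt_eq _ ht,
    combinedCaputo, leftCaputo, rightCaputo]
  ring

theorem integral_combKernel_mul {f : ℝ → ℝ} {τ : ℝ} (hτ : τ ∈ Icc c d)
    (hr : γ.1 ≠ 0 → RightIntExists (compl α) d f τ)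
    (hl : γ.2 ≠ 0 → LeftIntExists (compl β) c f τ) :
    ∫ t in Icc c d, combKernel α β γ t τ * f t
      = γ.1 * rightInt (compl α) d f τ - γ.2 * leftInt (compl β) c f τ := by
  simp_rw [combKernel_mul_eq]
  rw [integral_sub
    (IntegrableOn.const_mul_of_ne_zero fun h1 => (hr h1).integrableOn hτ)
    (IntegrableOn.const_mul_of_ne_zero fun h1 => (hl h1).integrableOn hτ),
    integral_const_mul, integral_const_mul, ← leftInt_eq _ hτ, ← rightInt_eq _ hτ]

/-- This is the function produced by transposing `combKernel`; the minus sign in its derivative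
cancels against that of integration by parts. -/
theorem hasDerivWithinAt_dualInt {f : ℝ → ℝ}
    (hr : γ.1 ≠ 0 → RightRLExists α c d f) (hl : γ.2 ≠ 0 → LeftRLExists β c d f)
    {τ : ℝ} (hτ : τ ∈ Icc c d) :
    HasDerivWithinAt (fun r => γ.1 * rightInt (compl α) d f r - γ.2 * leftInt (compl β) c f r)
      (-dualRL β α γ c d f τ) (Icc c d) τ := by
  have h1 : HasDerivWithinAt (fun r => γ.1 * rightInt (compl α) d f r)
      (-(γ.1 * rightRL α c d f τ)) (Icc c d) τ := by
    by_cases hγ : γ.1 = 0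
    · simpa [hγ] using hasDerivWithinAt_const τ (Icc c d) (0 : ℝ)
    · refine (((hr hγ).2 τ hτ).hasDerivWithinAt.const_mul γ.1).neg.congr_of_mem ?_ hτ
      intro r _
      simp
  have h2 : HasDerivWithinAt (fun r => γ.2 * leftInt (compl β) c f r)
      (γ.2 * leftRL β c d f τ) (Icc c d) τ := by
    by_cases hγ : γ.2 = 0
    · simpa [hγ] using hasDerivWithinAt_const τ (Icc c d) (0 : ℝ)
    · exact ((hl hγ).2 τ hτ).hasDerivWithinAt.const_mul γ.2
  exact (h1.sub h2).congr_deriv (by rw [dualRL]; ring)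

/-- Integration by parts against a function that vanishes at both ends. -/
theorem integral_deriv_mul_of_hasDerivWithinAt (hcd : c ≤ d) {h Φ φ : ℝ → ℝ}
    (hh : ContDiff ℝ 1 h) (hc : h c = 0) (hd : h d = 0)
    (hΦ : ∀ t ∈ Icc c d, HasDerivWithinAt Φ (-φ t) (Icc c d) t) (hφ : ContinuousOn φ (Icc c d)) :
    ∫ t in Icc c d, deriv h t * Φ t = ∫ t in Icc c d, h t * φ t := by
  have hΦc : ContinuousOn Φ (Icc c d) := fun t ht => (hΦ t ht).continuousWithinAt
  have hdc : Continuous (deriv h) := hh.continuous_deriv le_rfl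
  have i1 : ContinuousOn (fun t => deriv h t * Φ t) (Icc c d) := hdc.continuousOn.mul hΦc
  have i2 : ContinuousOn (fun t => h t * φ t) (Icc c d) := hh.continuous.continuousOn.mul hφ
  have key := intervalIntegral.integral_eq_sub_of_hasDerivAt_of_le hcd
    (f := fun t => h t * Φ t) (f' := fun t => deriv h t * Φ t - h t * φ t)
    (hh.continuous.continuousOn.mul hΦc)
    (fun t ht => (((hh.differentiable one_ne_zero).differentiableAt (x := t)).hasDerivAt.mul
        ((hΦ t (Ioo_subset_Icc_self ht)).hasDerivAt (Icc_mem_nhds ht.1 ht.2))).congr_deriv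
          (by ring))
    ((i1.sub i2).intervalIntegrable_of_Icc hcd)
  rw [intervalIntegral.integral_sub (i1.intervalIntegrable_of_Icc hcd)
    (i2.intervalIntegrable_of_Icc hcd), hc, hd, zero_mul, zero_mul, sub_zero, sub_eq_zero,
    intervalIntegral.integral_of_le hcd, intervalIntegral.integral_of_le hcd] at key
  rwa [integral_Icc_eq_integral_Ioc, integral_Icc_eq_integral_Ioc]

theorem exists_nonneg_bound_of_continuousOn {X : Type*} [TopologicalSpace X] {K : Set X}
    (hK : IsCompact K) {f : X → ℝ} (hf : ContinuousOn f K) :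
    ∃ C, 0 ≤ C ∧ ∀ t ∈ K, |f t| ≤ C := by
  obtain ⟨C, hC⟩ := hK.exists_bound_of_continuousOn hf
  exact ⟨max C 0, le_max_right _ _, fun t ht => (hC t ht).trans (le_max_left _ _)⟩

/-- Transpose the kernel by Fubini, then integrate by parts classically; boundary terms vanish with
`h`. -/
theorem integral_mul_combKernel_deriv {C : ℝ} (hcd : c ≤ d)
    (hα : Measurable (Function.uncurry α)) (hβ : Measurable (Function.uncurry β))
    (hi : ∀ t ∈ Icc c d, IntegrableOn (combKernel α β γ t) (Icc c d))
    (hb : ∀ t ∈ Icc c d, ∫ τ in Icc c d, |combKernel α β γ t τ| ≤ C)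
    {f h : ℝ → ℝ} (hf : ContinuousOn f (Icc c d)) (hh : ContDiff ℝ 1 h)
    (hc : h c = 0) (hd : h d = 0)
    (hr : γ.1 ≠ 0 → RightRLExists α c d f) (hl : γ.2 ≠ 0 → LeftRLExists β c d f)
    (hdual : ContinuousOn (dualRL β α γ c d f) (Icc c d)) :
    ∫ t in Icc c d, f t * ∫ τ in Icc c d, combKernel α β γ t τ * deriv h τ
      = ∫ t in Icc c d, h t * dualRL β α γ c d f t := by
  have hdc : Continuous (deriv h) := hh.continuous_deriv le_rfl
  obtain ⟨M, -, hM⟩ := exists_nonneg_bound_of_continuousOn isCompact_Icc hf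
  obtain ⟨N, hN0, hN⟩ := exists_nonneg_bound_of_continuousOn isCompact_Icc
    (hdc.continuousOn (s := Icc c d))
  rw [integral_mul_integral_swap (measurable_combKernel hα hβ) measurableSet_Icc measurableSet_Icc
    isCompact_Icc.measure_ne_top hN0 hi hb (hf.aestronglyMeasurable measurableSet_Icc) hM
    hdc.aestronglyMeasurable hN, ← integral_deriv_mul_of_hasDerivWithinAt hcd hh hc hd
      (fun t ht => hasDerivWithinAt_dualInt hr hl ht) hdual]
  refine setIntegral_congr_fun measurableSet_Icc fun τ hτ => ?_
  rw [integral_combKernel_mul hτ (fun h1 => (hr h1).1 τ hτ) (fun h1 => (hl h1).1 τ hτ)]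

/-- For `t ≤ T ≤ τ` only the right Caputo part of the kernel survives. Its transpose integrates `f`
over `[c, T]`, which is the left integral from `c` minus the left integral from `T`. -/
theorem integral_mul_combKernel_deriv_tail {C T : ℝ} (hcT : c ≤ T) (hTd : T ≤ d)
    (hα : Measurable (Function.uncurry α)) (hβ : Measurable (Function.uncurry β))
    (hi : ∀ t ∈ Icc c T, IntegrableOn (combKernel α β γ t) (Icc T d))
    (hb : ∀ t ∈ Icc c T, ∫ τ in Icc T d, |combKernel α β γ t τ| ≤ C)
    {f h : ℝ → ℝ} (hf : ContinuousOn f (Icc c T)) (hh : ContDiff ℝ 1 h)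
    (hT : h T = 0) (hd : h d = 0)
    (hl : LeftRLExists β c d f) (hlT : LeftRLExists β T d f)
    (hlc : ContinuousOn (leftRL β c d f) (Icc T d))
    (hlTc : ContinuousOn (leftRL β T d f) (Icc T d)) :
    ∫ t in Icc c T, f t * ∫ τ in Icc T d, combKernel α β γ t τ * deriv h τ
      = ∫ t in Icc T d, h t * (γ.2 * (leftRL β c d f t - leftRL β T d f t)) := by
  have hdc : Continuous (deriv h) := hh.continuous_deriv le_rfl
  obtain ⟨M, -, hM⟩ := exists_nonneg_bound_of_continuousOn isCompact_Icc hf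
  obtain ⟨N, hN0, hN⟩ := exists_nonneg_bound_of_continuousOn isCompact_Icc
    (hdc.continuousOn (s := Icc T d))
  have hsub : Icc T d ⊆ Icc c d := Icc_subset_Icc_left hcT
  rw [integral_mul_integral_swap (measurable_combKernel hα hβ) measurableSet_Icc measurableSet_Icc
    isCompact_Icc.measure_ne_top hN0 hi hb (hf.aestronglyMeasurable measurableSet_Icc) hM
    hdc.aestronglyMeasurable hN, ← integral_deriv_mul_of_hasDerivWithinAt hTd hh hT hd
      (φ := fun t => γ.2 * (leftRL β c d f t - leftRL β T d f t))
      (Φ := fun r => -(γ.2 * (leftInt (compl β) c f r - leftInt (compl β) T f r)))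
      (fun t ht => ((((hl.2 t (hsub ht)).hasDerivWithinAt.mono hsub).sub
        (hlT.2 t ht).hasDerivWithinAt).const_mul γ.2).neg)
      (continuousOn_const.mul (hlc.sub hlTc))]
  refine setIntegral_congr_fun measurableSet_Icc fun τ hτ => ?_
  congr 1
  have hI := (hl.1 τ (hsub hτ)).integrableOn (hsub hτ)
  have hcongr : ∫ t in Icc c T, combKernel α β γ t τ * f t
      = ∫ t in Icc c T, -γ.2 * (triKernel β τ t * f t) := by
    refine setIntegral_congr_fun measurableSet_Icc fun t ht => ?_
    rw [combKernel_mul_eq, triKernel_of_le (ht.2.trans hτ.1)]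
    ring
  rw [hcongr, integral_const_mul, leftInt_eq f (hsub hτ), leftInt_eq f hτ,
    integral_Icc_eq_integral_Ioc (x := T), ← Icc_union_Ioc_eq_Icc hcT hTd,
    setIntegral_union (Set.disjoint_left.2 fun x hx hx' => hx'.1.not_ge hx.2) measurableSet_Ioc
      (hI.mono_set (Icc_subset_Icc_right hTd)) (hI.mono_set (Ioc_subset_Icc_self.trans hsub))]
  ring

/-! ### Uniform integrability of the kernels. -/

/-- Continuous approximations of the sign of `t - τ`. -/
noncomputable def clampSign (t : ℝ) (k : ℕ) : BoundedContinuousFunction ℝ ℝ :=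
  BoundedContinuousFunction.ofNormedAddCommGroup (fun τ => max (-1) (min 1 (k * (t - τ))))
    (by fun_prop) 1 fun τ => by
      rw [Real.norm_eq_abs, abs_le]
      exact ⟨le_max_left _ _, max_le (by norm_num) (min_le_left _ _)⟩

theorem norm_clampSign_le (t : ℝ) (k : ℕ) : ‖clampSign t k‖ ≤ 1 :=
  BoundedContinuousFunction.norm_ofNormedAddCommGroup_le _ zero_le_one _

theorem abs_clampSign_le (t : ℝ) (k : ℕ) (τ : ℝ) : |clampSign t k τ| ≤ 1 :=
  ((clampSign t k).norm_coe_le_norm τ).trans (norm_clampSign_le t k)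

theorem eventually_clampSign_of_lt {t τ : ℝ} (h : τ < t) :
    ∀ᶠ k : ℕ in Filter.atTop, clampSign t k τ = 1 := by
  obtain ⟨N, hN⟩ := exists_nat_ge (1 / (t - τ))
  filter_upwards [Filter.eventually_ge_atTop N] with k hk
  have h1 : 1 ≤ (k : ℝ) * (t - τ) :=
    (div_le_iff₀ (sub_pos.2 h)).1 (hN.trans (by exact_mod_cast hk))
  change max (-1) (min 1 ((k : ℝ) * (t - τ))) = 1
  rw [min_eq_left h1, max_eq_right (by norm_num)]

theorem eventually_clampSign_of_gt {t τ : ℝ} (h : t < τ) :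
    ∀ᶠ k : ℕ in Filter.atTop, clampSign t k τ = -1 := by
  obtain ⟨N, hN⟩ := exists_nat_ge (1 / (τ - t))
  filter_upwards [Filter.eventually_ge_atTop N] with k hk
  have h1 : 1 ≤ (k : ℝ) * (τ - t) :=
    (div_le_iff₀ (sub_pos.2 h)).1 (hN.trans (by exact_mod_cast hk))
  change max (-1) (min 1 ((k : ℝ) * (t - τ))) = -1
  exact max_eq_left ((min_le_right _ _).trans (by linarith))

/-- Banach–Steinhaus for the functionals `u ↦ ∫ m t τ * u τ` on bounded continuous functions. Since
`m t` is nonnegative before `t` and nonpositive after, testing on `clampSign t k` and letting `k`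
grow recovers the full L¹ norm by dominated convergence. -/
theorem exists_forall_integral_abs_le {m : ℝ → ℝ → ℝ} {I S : Set ℝ} (hS : MeasurableSet S)
    (hi : ∀ t ∈ I, IntegrableOn (m t) S)
    (hpos : ∀ t ∈ I, ∀ τ ∈ S, τ < t → 0 ≤ m t τ) (hneg : ∀ t ∈ I, ∀ τ ∈ S, t < τ → m t τ ≤ 0)
    (hu : ∀ u : ℝ → ℝ, Continuous u → ∃ C, ∀ t ∈ I, |∫ τ in S, m t τ * u τ| ≤ C) :
    ∃ C, ∀ t ∈ I, ∫ τ in S, |m t τ| ≤ C := by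
  have hmul : ∀ t ∈ I, ∀ u : BoundedContinuousFunction ℝ ℝ,
      IntegrableOn (fun τ => m t τ * u τ) S := fun t ht u =>
    (hi t ht).mul_bdd (c := ‖u‖) u.continuous.aestronglyMeasurable
      (Filter.Eventually.of_forall u.norm_coe_le_norm)
  let A : I → BoundedContinuousFunction ℝ ℝ →L[ℝ] ℝ := fun t =>
    LinearMap.mkContinuous
      { toFun := fun u => ∫ τ in S, m t τ * u τ
        map_add' := fun u v => by
          simp only [BoundedContinuousFunction.coe_add, Pi.add_apply, mul_add]
          exact integral_add (hmul t t.2 u) (hmul t t.2 v)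
        map_smul' := fun r u => by
          simp only [BoundedContinuousFunction.coe_smul, smul_eq_mul, RingHom.id_apply,
            mul_left_comm _ r, integral_const_mul] }
      (∫ τ in S, |m t τ|) fun u => by
        simp only [LinearMap.coe_mk, AddHom.coe_mk]
        rw [← integral_mul_const]
        refine (norm_integral_le_integral_norm _).trans
          (integral_mono (hmul t t.2 u).norm ((hi t t.2).abs.mul_const _) fun τ => ?_)
        simp only [norm_mul, Real.norm_eq_abs]
        exact mul_le_mul_of_nonneg_left (u.norm_coe_le_norm τ) (abs_nonneg _)
  obtain ⟨C, hC⟩ := banach_steinhaus (g := A) fun u => by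
    obtain ⟨C, hC⟩ := hu u u.continuous
    exact ⟨C, fun t => hC t t.2⟩
  refine ⟨C, fun t ht => ?_⟩
  have hlim : Filter.Tendsto (fun k : ℕ => ∫ τ in S, m t τ * clampSign t k τ) Filter.atTop
      (nhds (∫ τ in S, |m t τ|)) := by
    refine tendsto_integral_of_dominated_convergence (fun τ => |m t τ|)
      (fun k => (hmul t ht _).aestronglyMeasurable) (hi t ht).abs (fun k => ?_) ?_
    · refine Filter.Eventually.of_forall fun τ => ?_
      rw [norm_mul, Real.norm_eq_abs, Real.norm_eq_abs]
      exact mul_le_of_le_one_right (abs_nonneg _) (abs_clampSign_le t k τ)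
    · have hne : ∀ᵐ τ ∂volume.restrict S, τ ≠ t :=
        ae_restrict_of_ae (Measure.ae_ne volume t)
      filter_upwards [ae_restrict_mem hS, hne] with τ hτ hτt
      rcases lt_or_gt_of_ne hτt with h | h
      · refine tendsto_const_nhds.congr' ?_
        filter_upwards [eventually_clampSign_of_lt h] with k hk
        rw [hk, mul_one, abs_of_nonneg (hpos t ht τ hτ h)]
      · refine tendsto_const_nhds.congr' ?_
        filter_upwards [eventually_clampSign_of_gt h] with k hk
        rw [hk, abs_of_nonpos (hneg t ht τ hτ h), mul_neg_one]
  refine le_of_tendsto' hlim fun k => ?_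
  calc ∫ τ in S, m t τ * clampSign t k τ = A ⟨t, ht⟩ (clampSign t k) := rfl
    _ ≤ ‖A ⟨t, ht⟩ (clampSign t k)‖ := le_abs_self _
    _ ≤ ‖A ⟨t, ht⟩‖ * ‖clampSign t k‖ := (A ⟨t, ht⟩).le_opNorm _
    _ ≤ C * 1 := mul_le_mul (hC _) (norm_clampSign_le t k) (norm_nonneg _)
        ((norm_nonneg _).trans (hC ⟨t, ht⟩))
    _ = C := mul_one C

theorem deriv_intervalIntegral_of_continuous {u : ℝ → ℝ} (hu : Continuous u) (c : ℝ) :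
    deriv (fun t => ∫ τ in c..t, u τ) = u :=
  funext fun t => (hu.integral_hasStrictDerivAt c t).hasDerivAt.deriv

theorem contDiff_one_intervalIntegral {u : ℝ → ℝ} (hu : Continuous u) (c : ℝ) :
    ContDiff ℝ 1 (fun t => ∫ τ in c..t, u τ) := by
  rw [contDiff_one_iff_deriv, deriv_intervalIntegral_of_continuous hu]
  exact ⟨fun t => (hu.integral_hasStrictDerivAt c t).hasDerivAt.differentiableAt, hu⟩

/-- If the combined Caputo derivatives of all `C¹` functions exist and are bounded, then the kernel
is integrable, uniformly in `t`. -/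
theorem exists_bound_combKernel {α β : ℝ → ℝ → ℝ} {γ : ℝ × ℝ} {c d : ℝ}
    (hα : ∀ t ∈ Icc c d, ∀ τ ∈ Icc c d, α t τ ∈ Ioo (0 : ℝ) 1)
    (hβ : ∀ t ∈ Icc c d, ∀ τ ∈ Icc c d, β t τ ∈ Ioo (0 : ℝ) 1)
    (hγ1 : 0 ≤ γ.1) (hγ2 : 0 ≤ γ.2)
    (hex : ∀ y : ℝ → ℝ, ContDiff ℝ 1 y → ∀ t ∈ Icc c d, CombinedCaputoExists α β γ c d y t)
    (hbd : ∀ y : ℝ → ℝ, ContDiff ℝ 1 y →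
      ∃ C, ∀ t ∈ Icc c d, |combinedCaputo α β γ c d y t| ≤ C) :
    (∀ t ∈ Icc c d, IntegrableOn (combKernel α β γ t) (Icc c d)) ∧
    ∃ C, ∀ t ∈ Icc c d, ∫ τ in Icc c d, |combKernel α β γ t τ| ≤ C := by
  have hi : ∀ t ∈ Icc c d, IntegrableOn (combKernel α β γ t) (Icc c d) := fun t ht => by
    -- The identity has derivative `1`, so its Caputo integrand is the kernel itself.
    simpa using (hex id contDiff_id t ht).integrableOn ht
  refine ⟨hi, exists_forall_integral_abs_le measurableSet_Icc hi
    (fun t ht τ hτ h => combKernel_nonneg hγ1 (hα t ht τ hτ) h)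
    (fun t ht τ hτ h => combKernel_nonpos hγ2 (hβ τ hτ t ht) h.le) fun u hu => ?_⟩
  -- Every continuous `u` is the derivative of a C¹ function, so bounds on Caputo derivatives are
  -- bounds on the kernel tested against `u`.
  have hy := contDiff_one_intervalIntegral hu c
  obtain ⟨C, hC⟩ := hbd _ hy
  refine ⟨C, fun t ht => ?_⟩
  have := hC t ht
  rwa [combinedCaputo_eq ht (hex _ hy t ht), deriv_intervalIntegral_of_continuous hu] at this

/-! ### Differential equations depending on a parameter. -/

theorem abs_max_min_sub_le (l u x y : ℝ) :
    |max l (min u x) - max l (min u y)| ≤ |x - y| :=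
  (abs_max_sub_max_le_max _ _ _ _).trans (by
    rw [sub_self, abs_zero, max_eq_right (abs_nonneg _)]
    refine (abs_min_sub_min_le_max _ _ _ _).trans ?_
    rw [sub_self, abs_zero, max_eq_right (abs_nonneg _)])

section Perturbation

variable {a b : ℝ} {G G₁ G₂ : ℝ → ℝ → ℝ → ℝ} {z : ℝ → ℝ}

/-- Solutions of a scalar differential equation persist under small perturbations of its right-hand
side, and depend on the parameter in a Lipschitz way. -/
theorem exists_perturbed_solutions (hab : a ≤ b)
    (hG : Continuous fun q : ℝ × ℝ × ℝ => G q.1 q.2.1 q.2.2)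
    (hG₁ : Continuous fun q : ℝ × ℝ × ℝ => G₁ q.1 q.2.1 q.2.2)
    (hG₂ : Continuous fun q : ℝ × ℝ × ℝ => G₂ q.1 q.2.1 q.2.2)
    (hd₁ : ∀ t ε ζ, HasDerivAt (fun e => G t e ζ) (G₁ t ε ζ) ε)
    (hd₂ : ∀ t ε ζ, HasDerivAt (fun u => G t ε u) (G₂ t ε ζ) ζ)
    (hz : ∀ t ∈ Icc a b, HasDerivWithinAt z (G t 0 (z t)) (Icc a b) t) :
    ∃ ε₀ > 0, ∃ C, 0 ≤ C ∧ ∃ w : ℝ → ℝ → ℝ, ∀ ε, |ε| ≤ ε₀ → w ε a = z a ∧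
      (∀ t ∈ Icc a b, HasDerivWithinAt (w ε) (G t ε (w ε t)) (Icc a b) t) ∧
      ∀ t ∈ Icc a b, |w ε t - z t| ≤ C * |ε| := by
  have hzc : ContinuousOn z (Icc a b) := fun t ht => (hz t ht).continuousWithinAt
  obtain ⟨R, hR0, hR⟩ := exists_nonneg_bound_of_continuousOn isCompact_Icc hzc
  set S : Set ℝ := Icc (-(R + 1)) (R + 1) with hS
  have hK : IsCompact (Icc a b ×ˢ (Icc (-1 : ℝ) 1 ×ˢ S)) :=
    isCompact_Icc.prod (isCompact_Icc.prod isCompact_Icc)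
  obtain ⟨M0, hM00, hM0⟩ := exists_nonneg_bound_of_continuousOn hK hG.continuousOn
  obtain ⟨M1, hM10, hM1⟩ := exists_nonneg_bound_of_continuousOn hK hG₁.continuousOn
  obtain ⟨M2, hM20, hM2⟩ := exists_nonneg_bound_of_continuousOn hK hG₂.continuousOn
  -- Truncation to the tube of radius `1` around `z` makes the field bounded and globally Lipschitz
  -- in `ζ`.
  let cl : ℝ → ℝ → ℝ := fun t ζ => max (z t - 1) (min (z t + 1) ζ)
  have hcl : ∀ t ∈ Icc a b, ∀ ζ, cl t ζ ∈ S := fun t ht ζ => by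
    have := abs_le.1 (hR t ht)
    exact ⟨le_max_of_le_left (by linarith), max_le (by linarith)
      ((min_le_left _ _).trans (by linarith))⟩
  have hclz : ∀ t ζ, |ζ - z t| ≤ 1 → cl t ζ = ζ := fun t ζ h => by
    have := abs_le.1 h
    simp only [cl]
    rw [min_eq_right (by linarith), max_eq_right (by linarith)]
  have hzS : ∀ t ∈ Icc a b, z t ∈ S := fun t ht => by
    have := abs_le.1 (hR t ht)
    exact ⟨by linarith, by linarith⟩
  -- The `+ 1` keeps `K` nonzero, as the closed form of the Grönwall bound divides by it.
  let K : NNReal := ⟨M2 + 1, by positivity⟩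
  have hK0 : (0 : ℝ) < K := by change 0 < M2 + 1; positivity
  have hlip : ∀ ε, |ε| ≤ 1 → ∀ t ∈ Icc a b, LipschitzWith K (fun ζ => G t ε (cl t ζ)) := by
    intro ε hε t ht
    refine LipschitzWith.of_dist_le_mul fun ζ ζ' => ?_
    rw [dist_comm, dist_comm ζ, Real.dist_eq, Real.dist_eq]
    refine (Convex.norm_image_sub_le_of_norm_hasDerivWithin_le (s := S) (C := (K : ℝ))
      (fun u _ => (hd₂ t ε u).hasDerivWithinAt) (fun u hu => ?_) (convex_Icc _ _)
      (hcl t ht ζ) (hcl t ht ζ')).trans ?_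
    · have := hM2 (t, ε, u) ⟨ht, abs_le.1 hε, hu⟩
      exact this.trans (by change M2 ≤ M2 + 1; linarith)
    · exact mul_le_mul_of_nonneg_left (abs_max_min_sub_le _ _ _ _) hK0.le
  have hbd : ∀ ε, |ε| ≤ 1 → ∀ t ∈ Icc a b, ∀ ζ, |G t ε (cl t ζ)| ≤ M0 := fun ε hε t ht ζ =>
    hM0 (t, ε, cl t ζ) ⟨ht, abs_le.1 hε, hcl t ht ζ⟩
  have hPL : ∀ ε, |ε| ≤ 1 → ∃ w : ℝ → ℝ, w a = z a ∧
      ∀ t ∈ Icc a b, HasDerivWithinAt w (G t ε (cl t (w t))) (Icc a b) t := by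
    intro ε hε
    -- The truncated field is bounded by `M0` everywhere, so the radius `M0 * (b - a)` gives
    -- existence on the whole interval at once.
    have hP : IsPicardLindelof (fun t ζ => G t ε (cl t ζ)) (⟨a, left_mem_Icc.2 hab⟩ : Icc a b)
        (z a) (⟨M0 * (b - a), mul_nonneg hM00 (sub_nonneg.2 hab)⟩ : NNReal) 0
        (⟨M0, hM00⟩ : NNReal) K :=
      { lipschitzOnWith := fun t ht => (hlip ε hε t ht).lipschitzOnWith
        continuousOn := fun ζ _ => hG.comp_continuousOn (continuousOn_id.prodMk
          (continuousOn_const.prodMk ((hzc.sub continuousOn_const).sup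
            ((hzc.add continuousOn_const).inf continuousOn_const))))
        norm_le := fun t ht ζ _ => hbd ε hε t ht ζ
        mul_max_le := by
          change M0 * max (b - a) (a - a) ≤ M0 * (b - a) - 0
          rw [sub_self, max_eq_left (sub_nonneg.2 hab), sub_zero] }
    exact hP.exists_eq_forall_mem_Icc_hasDerivWithinAt (x := z a) (Metric.mem_closedBall_self le_rfl)
  have hgr : ∀ ε, |ε| ≤ 1 → ∀ w : ℝ → ℝ, w a = z a →
      (∀ t ∈ Icc a b, HasDerivWithinAt w (G t ε (cl t (w t))) (Icc a b) t) →
      ∀ t ∈ Icc a b, |w t - z t| ≤ M1 / K * Real.exp (K * (b - a)) * |ε| := by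
    intro ε hε w hwa hw t ht
    have hright : ∀ {f : ℝ → ℝ} {f' t : ℝ}, t ∈ Ico a b → HasDerivWithinAt f f' (Icc a b) t →
        HasDerivWithinAt f f' (Ici t) t := fun ht h =>
      h.mono_of_mem_nhdsWithin (Icc_mem_nhdsGE_of_mem ht)
    -- Grönwall: `z` solves the field at parameter `ε` up to an error `M1 * |ε|`, by the mean value
    -- inequality in the parameter.
    have := dist_le_of_approx_trajectories_ODE_of_mem (v := fun t ζ => G t ε (cl t ζ))
      (s := fun _ => univ) (K := K) (f := w) (g := z) (f' := fun t => G t ε (cl t (w t)))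
      (g' := fun t => G t 0 (z t)) (a := a) (b := b) (εf := 0) (εg := M1 * |ε|) (δ := 0)
      (fun t ht => (hlip ε hε t (Ico_subset_Icc_self ht)).lipschitzOnWith)
      (fun t ht => (hw t ht).continuousWithinAt)
      (fun t ht => hright ht (hw t (Ico_subset_Icc_self ht)))
      (fun t _ => (dist_self _).le) (fun _ _ => mem_univ _) hzc
      (fun t ht => hright ht (hz t (Ico_subset_Icc_self ht)))
      (fun t ht => by
        have ht' := Ico_subset_Icc_self ht
        rw [hclz t (z t) (by simp), dist_comm, Real.dist_eq]
        have := Convex.norm_image_sub_le_of_norm_hasDerivWithin_le (s := Icc (-1 : ℝ) 1) (C := M1)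
          (x := 0) (y := ε) (f := fun e => G t e (z t))
          (fun u _ => (hd₁ t u (z t)).hasDerivWithinAt)
          (fun u hu => hM1 (t, u, z t) ⟨ht', hu, hzS t ht'⟩) (convex_Icc _ _)
          ⟨by norm_num, by norm_num⟩ (abs_le.1 hε)
        simpa using this)
      (fun _ _ => mem_univ _) (by rw [hwa, dist_self]) t ht
    rw [Real.dist_eq] at this
    refine this.trans ?_
    rw [gronwallBound_of_K_ne_0 hK0.ne', zero_add]
    beta_reduce
    rw [zero_mul, zero_add]
    have h1 : Real.exp (K * (t - a)) - 1 ≤ Real.exp (K * (b - a)) := by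
      have : Real.exp (K * (t - a)) ≤ Real.exp (K * (b - a)) :=
        Real.exp_le_exp.2 (mul_le_mul_of_nonneg_left (by linarith [ht.2]) hK0.le)
      linarith
    calc M1 * |ε| / K * (Real.exp (K * (t - a)) - 1)
        ≤ M1 * |ε| / K * Real.exp (K * (b - a)) := by gcongr
      _ = _ := by ring
  set C : ℝ := M1 / K * Real.exp (K * (b - a)) with hC
  have hC0 : 0 ≤ C := by positivity
  have hε1 : ∀ ε, |ε| ≤ min 1 (1 / (C + 1)) → |ε| ≤ 1 := fun ε h => h.trans (min_le_left _ _)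
  choose! w hw using hPL
  refine ⟨min 1 (1 / (C + 1)), by positivity, C, hC0, w, fun ε hε => ?_⟩
  obtain ⟨h1, h2⟩ := hw ε (hε1 ε hε)
  have h3 := hgr ε (hε1 ε hε) (w ε) h1 h2
  refine ⟨h1, fun t ht => ?_, h3⟩
  have h4 := h2 t ht
  -- For `|ε| ≤ 1 / (C + 1)` the solution never leaves the tube, so it solves the original equation.
  rwa [hclz t (w ε t)] at h4
  calc |w ε t - z t| ≤ C * |ε| := h3 t ht
    _ ≤ (C + 1) * (1 / (C + 1)) := by
        gcongr
        · linarith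
        · exact hε.trans (min_le_right _ _)
    _ = 1 := by field_simp

/-- Uniform continuity on a compact neighbourhood of the graph of `z`. -/
theorem exists_uniform_modulus {F : ℝ → ℝ → ℝ → ℝ}
    (hF : Continuous fun q : ℝ × ℝ × ℝ => F q.1 q.2.1 q.2.2) (hz : ContinuousOn z (Icc a b))
    {η : ℝ} (hη : 0 < η) :
    ∃ δ > 0, ∀ t ∈ Icc a b, ∀ ε u, |ε| ≤ δ → |u| ≤ δ →
      |F t ε (z t + u) - F t 0 (z t)| ≤ η := by
  have hc : ContinuousOn (fun q : ℝ × ℝ × ℝ => F q.1 q.2.1 (z q.1 + q.2.2))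
      (Icc a b ×ˢ Metric.closedBall 0 1) :=
    hF.comp_continuousOn (continuousOn_fst.prodMk
      ((continuous_fst.comp continuous_snd).continuousOn.prodMk
        ((hz.comp continuousOn_fst fun q hq => hq.1).add
          (continuous_snd.comp continuous_snd).continuousOn)))
  have hu := (isCompact_Icc.prod (isCompact_closedBall _ _)).uniformContinuousOn_of_continuous hc
  obtain ⟨δ, hδ, h⟩ := Metric.uniformContinuousOn_iff.1 hu η hη
  refine ⟨min 1 (δ / 2), by positivity, fun t ht ε u hε hu' => ?_⟩
  have hm : ‖((ε, u) : ℝ × ℝ)‖ ≤ min 1 (δ / 2) := max_le hε hu'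
  have := h (t, ε, u) ⟨ht, by simpa using hm.trans (min_le_left _ _)⟩ (t, 0, 0)
    ⟨ht, Metric.mem_closedBall_self zero_le_one⟩ (by
      have h2 : dist ((t, ε, u) : ℝ × ℝ × ℝ) (t, 0, 0) = ‖((ε, u) : ℝ × ℝ)‖ := by
        rw [dist_eq_norm]
        simp [Prod.norm_def]
      rw [h2]
      exact (hm.trans (min_le_right _ _)).trans_lt (half_lt_self hδ))
  rw [Real.dist_eq] at this
  simpa using this.le

/-- Since `l` solves the adjoint equation, differentiating `l * (w ε - z) - ε * ∫ l * G₁` in `t`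
cancels all first-order terms. What remains is `l` times a Taylor remainder that is `o(ε)` uniformly
in `t`; the mean value inequality on `[a, b]` concludes. -/
theorem hasDerivAt_perturbed_solutions
    (hG₁ : Continuous fun q : ℝ × ℝ × ℝ => G₁ q.1 q.2.1 q.2.2)
    (hG₂ : Continuous fun q : ℝ × ℝ × ℝ => G₂ q.1 q.2.1 q.2.2)
    (hd₁ : ∀ t ε ζ, HasDerivAt (fun e => G t e ζ) (G₁ t ε ζ) ε)
    (hd₂ : ∀ t ε ζ, HasDerivAt (fun u => G t ε u) (G₂ t ε ζ) ζ)
    (hz : ∀ t ∈ Icc a b, HasDerivWithinAt z (G t 0 (z t)) (Icc a b) t)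
    {ε₀ C : ℝ} (hε₀ : 0 < ε₀) (hC : 0 ≤ C) {w : ℝ → ℝ → ℝ}
    (hwa : ∀ ε, |ε| ≤ ε₀ → w ε a = z a)
    (hw : ∀ ε, |ε| ≤ ε₀ →
      ∀ t ∈ Icc a b, HasDerivWithinAt (w ε) (G t ε (w ε t)) (Icc a b) t)
    (hwz : ∀ ε, |ε| ≤ ε₀ → ∀ t ∈ Icc a b, |w ε t - z t| ≤ C * |ε|)
    {T : ℝ} (hT : T ∈ Icc a b) {l : ℝ → ℝ} (hl : ContinuousOn l (Icc a b))
    (hl' : ∀ t ∈ Icc a b, HasDerivWithinAt l (-(G₂ t 0 (z t)) * l t) (Icc a b) t) :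
    HasDerivAt (fun ε => l T * w ε T) (∫ τ in a..T, l τ * G₁ τ 0 (z τ)) 0 := by
  have hab : a ≤ b := hT.1.trans hT.2
  have hzc : ContinuousOn z (Icc a b) := fun t ht => (hz t ht).continuousWithinAt
  obtain ⟨Λ, hΛ0, hΛ⟩ := exists_nonneg_bound_of_continuousOn isCompact_Icc hl
  have hAc : ContinuousOn (fun τ => l τ * G₁ τ 0 (z τ)) (Icc a b) :=
    hl.mul (hG₁.comp_continuousOn (continuousOn_id.prodMk (continuousOn_const.prodMk hzc)))
  have hAint : ∀ t ∈ Icc a b, HasDerivWithinAt (fun t => ∫ τ in a..t, l τ * G₁ τ 0 (z τ))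
      (l t * G₁ t 0 (z t)) (Icc a b) t := fun t ht => by
    have : Fact (t ∈ Icc a b) := ⟨ht⟩
    exact intervalIntegral.integral_hasDerivWithinAt_right
      ((hAc.mono (Icc_subset_Icc_right ht.2)).intervalIntegrable_of_Icc ht.1)
      (hAc.stronglyMeasurableAtFilter_nhdsWithin measurableSet_Icc t) (hAc t ht)
  have hw0 : w 0 T = z T := by
    have := hwz 0 (by simpa using hε₀.le) T hT
    rw [abs_zero, mul_zero] at this
    exact sub_eq_zero.1 (abs_nonpos_iff.1 this)
  rw [hasDerivAt_iff_isLittleO_nhds_zero, Asymptotics.isLittleO_iff]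
  intro κ hκ
  -- Tuned so that the final estimate is at most `κ * |ε|`; the `+ 1` avoids a zero denominator.
  set η : ℝ := κ / (Λ * (1 + C) * (b - a) + 1) with hη
  have hba := sub_nonneg.2 hab
  have hη0 : 0 < η := by positivity
  obtain ⟨δ₁, hδ₁, hu₁⟩ := exists_uniform_modulus hG₁ hzc hη0
  obtain ⟨δ₂, hδ₂, hu₂⟩ := exists_uniform_modulus hG₂ hzc hη0
  have hev : ∀ᶠ ε : ℝ in nhds 0, |ε| < min (min ε₀ δ₁) (min δ₂ (δ₂ / (C + 1))) := by
    have : (0 : ℝ) < min (min ε₀ δ₁) (min δ₂ (δ₂ / (C + 1))) := by positivity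
    filter_upwards [Metric.ball_mem_nhds (0 : ℝ) this] with ε hε
    rwa [mem_ball_zero_iff] at hε
  filter_upwards [hev] with ε hε
  obtain ⟨⟨h₀, h₁⟩, h₂, h₃⟩ := by simpa only [lt_min_iff] using hε
  have hwδ : ∀ t ∈ Icc a b, |w ε t - z t| ≤ δ₂ := fun t ht => by
    refine (hwz ε h₀.le t ht).trans ?_
    calc C * |ε| ≤ (C + 1) * (δ₂ / (C + 1)) := by gcongr; linarith
      _ = δ₂ := by field_simp
  have hrem : ∀ t ∈ Icc a b, |G t ε (w ε t) - G t 0 (z t) - G₂ t 0 (z t) * (w ε t - z t)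
      - ε * G₁ t 0 (z t)| ≤ η * ((1 + C) * |ε|) := by
    intro t ht
    -- The Taylor remainder is split into an increment in `ζ` at parameter `ε` and an increment in
    -- the parameter at `z t`; in each, the linear part is subtracted before the mean value
    -- inequality.
    have e1 : |(G t ε (w ε t) - G₂ t 0 (z t) * w ε t) - (G t ε (z t) - G₂ t 0 (z t) * z t)|
        ≤ η * |w ε t - z t| := by
      refine Convex.norm_image_sub_le_of_norm_hasDerivWithin_le
        (s := Metric.closedBall (z t) δ₂) (f := fun u => G t ε u - G₂ t 0 (z t) * u)
        (f' := fun u => G₂ t ε u - G₂ t 0 (z t))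
        (fun u _ => (((hd₂ t ε u).sub
          ((hasDerivAt_id u).const_mul _)).congr_deriv (by simp)).hasDerivWithinAt)
        (fun u hu => ?_) (convex_closedBall _ _) (Metric.mem_closedBall_self hδ₂.le)
        (by simpa [Real.dist_eq] using hwδ t ht)
      have := hu₂ t ht ε (u - z t) h₂.le (by simpa [Real.dist_eq] using hu)
      simpa using this
    have e2 : |(G t ε (z t) - G₁ t 0 (z t) * ε) - (G t 0 (z t) - G₁ t 0 (z t) * 0)|
        ≤ η * |ε - 0| := by
      refine Convex.norm_image_sub_le_of_norm_hasDerivWithin_le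
        (s := Metric.closedBall (0 : ℝ) δ₁) (f := fun u => G t u (z t) - G₁ t 0 (z t) * u)
        (f' := fun u => G₁ t u (z t) - G₁ t 0 (z t))
        (fun u _ => (((hd₁ t u (z t)).sub
          ((hasDerivAt_id u).const_mul _)).congr_deriv (by simp)).hasDerivWithinAt)
        (fun u hu => ?_) (convex_closedBall _ _) (Metric.mem_closedBall_self hδ₁.le)
        (by simpa [Real.dist_eq] using h₁.le)
      have := hu₁ t ht u 0 (by simpa [Real.dist_eq] using hu) (by simpa using hδ₁.le)
      simpa using this
    have e3 := hwz ε h₀.le t ht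
    calc _ = |((G t ε (w ε t) - G₂ t 0 (z t) * w ε t) - (G t ε (z t) - G₂ t 0 (z t) * z t))
          + ((G t ε (z t) - G₁ t 0 (z t) * ε) - (G t 0 (z t) - G₁ t 0 (z t) * 0))| := by
          congr 1; ring
      _ ≤ η * |w ε t - z t| + η * |ε - 0| := (abs_add_le _ _).trans (add_le_add e1 e2)
      _ ≤ η * (C * |ε|) + η * |ε| := by rw [sub_zero]; gcongr
      _ = _ := by ring
  have hmv := Convex.norm_image_sub_le_of_norm_hasDerivWithin_le (s := Icc a b)
    (f := fun t => l t * (w ε t - z t) - ε * ∫ τ in a..t, l τ * G₁ τ 0 (z τ))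
    (f' := fun t => l t * (G t ε (w ε t) - G t 0 (z t) - G₂ t 0 (z t) * (w ε t - z t)
      - ε * G₁ t 0 (z t))) (C := Λ * (η * ((1 + C) * |ε|)))
    (fun t ht => (((hl' t ht).mul ((hw ε h₀.le t ht).sub (hz t ht))).sub
      ((hAint t ht).const_mul ε)).congr_deriv (by simp only [Pi.sub_apply]; ring))
    (fun t ht => by
      rw [norm_mul]
      exact mul_le_mul (hΛ t ht) (hrem t ht) (norm_nonneg _) hΛ0)
    (convex_Icc _ _) (left_mem_Icc.2 hab) hT
  rw [hwa ε h₀.le, sub_self, mul_zero, intervalIntegral.integral_same, mul_zero, sub_zero,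
    sub_zero] at hmv
  rw [zero_add, hw0]
  calc ‖l T * w ε T - l T * z T - ε • ∫ τ in a..T, l τ * G₁ τ 0 (z τ)‖
      = ‖l T * (w ε T - z T) - ε * ∫ τ in a..T, l τ * G₁ τ 0 (z τ)‖ := by
        rw [smul_eq_mul, mul_sub]
    _ ≤ Λ * (η * ((1 + C) * |ε|)) * ‖T - a‖ := hmv
    _ ≤ Λ * (η * ((1 + C) * |ε|)) * (b - a) := by
        have : ‖T - a‖ ≤ b - a := by
          rw [Real.norm_of_nonneg (sub_nonneg.2 hT.1)]; linarith [hT.2]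
        gcongr
    _ = η * (Λ * (1 + C) * (b - a)) * |ε| := by ring
    _ ≤ η * (Λ * (1 + C) * (b - a) + 1) * |ε| := by gcongr; linarith
    _ = κ * ‖ε‖ := by rw [hη, Real.norm_eq_abs]; field_simp

end Perturbation

/-! ### The Lagrangian and the Herglotz right-hand side along a variation. -/

theorem hasDerivAt_setIntegral_of_continuous {Y : Type*} [TopologicalSpace Y] [MeasurableSpace Y]
    [OpensMeasurableSpace Y] [SecondCountableTopology Y] {μ : Measure Y}
    [IsFiniteMeasureOnCompacts μ] {K : Set Y} (hK : IsCompact K) (hKm : MeasurableSet K)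
    {F F' : ℝ → Y → ℝ} (hF : Continuous (Function.uncurry F))
    (hF' : Continuous (Function.uncurry F'))
    (h : ∀ e y, HasDerivAt (fun e => F e y) (F' e y) e) (e : ℝ) :
    HasDerivAt (fun e => ∫ y in K, F e y ∂μ) (∫ y in K, F' e y ∂μ) e := by
  have : IsFiniteMeasure (μ.restrict K) := ⟨by simpa using hK.measure_lt_top⟩
  obtain ⟨C, hC0, hC⟩ := exists_nonneg_bound_of_continuousOn
    ((isCompact_closedBall e 1).prod hK) hF'.continuousOn
  obtain ⟨N, -, hN⟩ := exists_nonneg_bound_of_continuousOn hK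
    (hF.comp (Continuous.prodMk_right e)).continuousOn
  refine (hasDerivAt_integral_of_dominated_loc_of_deriv_le (bound := fun _ => C)
    (Metric.closedBall_mem_nhds e one_pos) (Filter.Eventually.of_forall fun e' =>
      (hF.comp (Continuous.prodMk_right e')).aestronglyMeasurable)
    (Integrable.of_bound (hF.comp (Continuous.prodMk_right e)).aestronglyMeasurable N ?_)
    (hF'.comp (Continuous.prodMk_right e)).aestronglyMeasurable ?_ (integrable_const C)
    (Filter.Eventually.of_forall fun y e' _ => h e' y)).2
  · filter_upwards [ae_restrict_mem hKm] with y hy using hN y hy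
  · filter_upwards [ae_restrict_mem hKm] with y hy e' he' using hC (e', y) ⟨he', hy⟩

namespace Data

variable {n : ℕ} {D : Data n}

theorem isCompact_Ω : IsCompact D.Ω := isCompact_Icc

theorem isCompact_P : IsCompact D.P := isCompact_Icc.prod isCompact_Icc

theorem measurableSet_Ω : MeasurableSet D.Ω := isCompact_Icc.isClosed.measurableSet

variable (D) in
/-- Arguments of the Lagrangian whose base point lies in `P`. -/
def argSet : Set (Arg n) := {q | (q.1, q.2.1) ∈ D.P}

theorem argSet_eq : D.argSet = Icc D.a D.b ×ˢ (D.Ω ×ˢ univ) := by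
  ext q
  simp [argSet, P]

theorem interior_Ω : interior D.Ω = univ.pi fun i => Ioo (D.lo i) (D.hi i) := by
  rw [Ω, ← pi_univ_Icc, interior_pi_set finite_univ]
  simp

namespace Standing

theorem lo_le_hi (hD : D.Standing) : D.lo ≤ D.hi := fun i => (hD.lo_lt_hi i).le

theorem lo_mem_Ω (hD : D.Standing) : D.lo ∈ D.Ω := left_mem_Icc.2 hD.lo_le_hi

theorem interior_Ω_nonempty (hD : D.Standing) : (interior D.Ω).Nonempty := by
  rw [interior_Ω, univ_pi_nonempty_iff]
  exact fun i => nonempty_Ioo.2 (hD.lo_lt_hi i)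

/-- Convexity and nonempty interior; needed for the derivative within `argSet` to be continuous up
to the boundary. -/
theorem uniqueDiffOn_argSet (hD : D.Standing) : UniqueDiffOn ℝ D.argSet := by
  refine uniqueDiffOn_convex ?_ ?_
  · rw [argSet_eq]
    exact (convex_Icc _ _).prod ((convex_Icc _ _).prod convex_univ)
  · rw [argSet_eq, interior_prod_eq, interior_prod_eq, interior_Icc, interior_univ]
    exact (nonempty_Ioo.2 hD.a_lt_b).prod (hD.interior_Ω_nonempty.prod univ_nonempty)

end Standing

variable (D) in
/-- The total derivative of the Lagrangian. -/
noncomputable def dL (q : Arg n) : Arg n →L[ℝ] ℝ := fderivWithin ℝ D.L D.argSet q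

theorem Standing.continuousOn_L (hD : D.Standing) : ContinuousOn D.L D.argSet :=
  hD.L_contDiff.continuousOn

theorem Standing.continuousOn_dL (hD : D.Standing) : ContinuousOn D.dL D.argSet :=
  ContDiffOn.continuousOn_fderivWithin hD.L_contDiff hD.uniqueDiffOn_argSet le_rfl

/-- A curve lying in `argSet` for all parameters has a two-sided derivative even over a boundary
point of `P`. Variations qualify: they leave `t` and `s` fixed, and the other arguments are
unrestricted. -/
theorem Standing.hasDerivAt_L (hD : D.Standing) {q : ℝ → Arg n} {q' : Arg n} {e : ℝ}
    (hq : HasDerivAt q q' e) (hm : ∀ e, q e ∈ D.argSet) :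
    HasDerivAt (fun e => D.L (q e)) (D.dL (q e) q') e := by
  have h := ((hD.L_contDiff.differentiableOn one_ne_zero) (q e) (hm e)).hasFDerivWithinAt
  rw [← hasDerivWithinAt_univ] at hq ⊢
  exact h.comp_hasDerivWithinAt e hq fun e _ => hm e

section Partials

variable {t : ℝ} {s : Fin n → ℝ} {x v z : ℝ} {w : Fin n → ℝ}

theorem partialX_eq (hD : D.Standing) (hp : (t, s) ∈ D.P) :
    partialX D.L (t, s, x, v, w, z) = D.dL (t, s, x, v, w, z) (0, 0, 1, 0, 0, 0) :=
  (hD.hasDerivAt_L (q := fun u => (t, s, u, v, w, z))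
    ((hasDerivAt_const x t).prodMk ((hasDerivAt_const x s).prodMk ((hasDerivAt_id x).prodMk
      ((hasDerivAt_const x v).prodMk ((hasDerivAt_const x w).prodMk (hasDerivAt_const x z))))))
    fun _ => hp).deriv

theorem partialV_eq (hD : D.Standing) (hp : (t, s) ∈ D.P) :
    partialV D.L (t, s, x, v, w, z) = D.dL (t, s, x, v, w, z) (0, 0, 0, 1, 0, 0) :=
  (hD.hasDerivAt_L (q := fun u => (t, s, x, u, w, z))
    ((hasDerivAt_const v t).prodMk ((hasDerivAt_const v s).prodMk ((hasDerivAt_const v x).prodMk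
      ((hasDerivAt_id v).prodMk ((hasDerivAt_const v w).prodMk (hasDerivAt_const v z))))))
    fun _ => hp).deriv

theorem hasDerivAt_L_z (hD : D.Standing) (hp : (t, s) ∈ D.P) (z : ℝ) :
    HasDerivAt (fun u => D.L (t, s, x, v, w, u)) (D.dL (t, s, x, v, w, z) (0, 0, 0, 0, 0, 1)) z :=
  hD.hasDerivAt_L (q := fun u => (t, s, x, v, w, u))
    ((hasDerivAt_const z t).prodMk ((hasDerivAt_const z s).prodMk ((hasDerivAt_const z x).prodMk
      ((hasDerivAt_const z v).prodMk ((hasDerivAt_const z w).prodMk (hasDerivAt_id z))))))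
    fun _ => hp

theorem partialZ_eq (hD : D.Standing) (hp : (t, s) ∈ D.P) :
    partialZ D.L (t, s, x, v, w, z) = D.dL (t, s, x, v, w, z) (0, 0, 0, 0, 0, 1) :=
  (hasDerivAt_L_z hD hp z).deriv

theorem partialW_eq (hD : D.Standing) (i : Fin n) (hp : (t, s) ∈ D.P) :
    partialW D.L i (t, s, x, v, w, z)
      = D.dL (t, s, x, v, w, z) (0, 0, 0, 0, Pi.single i 1, 0) := by
  have h := hD.hasDerivAt_L (q := fun u => (t, s, x, v, Function.update w i u, z))
    ((hasDerivAt_const (w i) t).prodMk ((hasDerivAt_const (w i) s).prodMk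
      ((hasDerivAt_const (w i) x).prodMk ((hasDerivAt_const (w i) v).prodMk
        ((hasDerivAt_update w i (w i)).prodMk (hasDerivAt_const (w i) z))))))
    fun _ => hp
  rw [Function.update_eq_self] at h
  exact h.deriv

theorem dL_apply (hD : D.Standing) (hp : (t, s) ∈ D.P) (x' v' : ℝ) (w' : Fin n → ℝ) :
    D.dL (t, s, x, v, w, z) (0, 0, x', v', w', 0)
      = x' * partialX D.L (t, s, x, v, w, z) + v' * partialV D.L (t, s, x, v, w, z)
        + ∑ i, w' i * partialW D.L i (t, s, x, v, w, z) := by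
  have h : ((0, 0, x', v', w', 0) : Arg n) = x' • (0, 0, 1, 0, 0, 0) + v' • (0, 0, 0, 1, 0, 0)
      + ∑ i, w' i • (0, 0, 0, 0, Pi.single i 1, 0) := by
    have hw : w' = ∑ i, w' i • (Pi.single i 1 : Fin n → ℝ) := by
      ext j
      simp [Finset.sum_apply, Pi.single_apply]
    ext
    all_goals simp [Prod.fst_sum, Prod.snd_sum]
    simp [Pi.single_apply]
  rw [h, map_add, map_add, map_smul, map_smul, map_sum, partialX_eq hD hp, partialV_eq hD hp]
  simp_rw [map_smul, partialW_eq hD _ hp, smul_eq_mul]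

end Partials

theorem Standing.continuousOn_partialX (hD : D.Standing) :
    ContinuousOn (partialX D.L) D.argSet :=
  (hD.continuousOn_dL.clm_apply continuousOn_const).congr fun _ hq => partialX_eq hD hq

theorem Standing.continuousOn_partialV (hD : D.Standing) :
    ContinuousOn (partialV D.L) D.argSet :=
  (hD.continuousOn_dL.clm_apply continuousOn_const).congr fun _ hq => partialV_eq hD hq

theorem Standing.continuousOn_partialW (hD : D.Standing) (i : Fin n) :
    ContinuousOn (partialW D.L i) D.argSet :=
  (hD.continuousOn_dL.clm_apply continuousOn_const).congr fun _ hq => partialW_eq hD i hq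

variable (D) in
/-- The nearest-point retraction onto `P`. -/
def clamp (p : ℝ × (Fin n → ℝ)) : ℝ × (Fin n → ℝ) :=
  (max D.a (min D.b p.1), D.lo ⊔ (D.hi ⊓ p.2))

theorem continuous_clamp : Continuous D.clamp :=
  (continuous_const.max (continuous_const.min continuous_fst)).prodMk
    (continuous_pi fun i => continuous_const.max
      (continuous_const.min ((continuous_apply i).comp continuous_snd)))

theorem Standing.clamp_mem (hD : D.Standing) (p : ℝ × (Fin n → ℝ)) : D.clamp p ∈ D.P :=
  ⟨⟨le_max_left _ _, max_le hD.a_lt_b.le (min_le_left _ _)⟩,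
    ⟨le_sup_left, sup_le hD.lo_le_hi inf_le_left⟩⟩

theorem clamp_of_mem {p : ℝ × (Fin n → ℝ)} (hp : p ∈ D.P) : D.clamp p = p :=
  Prod.ext (by
    change max D.a (min D.b p.1) = p.1
    rw [min_eq_right hp.1.2, max_eq_right hp.1.1]) (by
    change D.lo ⊔ (D.hi ⊓ p.2) = p.2
    rw [inf_eq_right.2 hp.2.2, sup_eq_right.2 hp.2.1])

variable (D) in
/-- The argument list of the Lagrangian along `X + ε H`, where `X` and `H` comprise a trajectory and
its fractional derivatives. -/
def argVar (X H : ℝ × (Fin n → ℝ) → ℝ × ℝ × (Fin n → ℝ)) (p : ℝ × (Fin n → ℝ)) (ε ζ : ℝ) : Arg n :=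
  let c := D.clamp p
  (c.1, c.2, (X c).1 + ε * (H c).1, (X c).2.1 + ε * (H c).2.1,
    (X c).2.2 + ε • (H c).2.2, ζ)

section Variation

variable {X H : ℝ × (Fin n → ℝ) → ℝ × ℝ × (Fin n → ℝ)}

theorem Standing.argVar_mem (hD : D.Standing) (p : ℝ × (Fin n → ℝ)) (ε ζ : ℝ) :
    D.argVar X H p ε ζ ∈ D.argSet := hD.clamp_mem p

/-- Retracting onto `P` makes functions continuous on `P` globally continuous without changing them
there, as the parametric integral and perturbation lemmas require. -/
theorem Standing.continuous_comp_clamp (hD : D.Standing) {E : Type*} [TopologicalSpace E]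
    {X : ℝ × (Fin n → ℝ) → E} (hX : ContinuousOn X D.P) : Continuous fun p => X (D.clamp p) :=
  hX.comp_continuous continuous_clamp hD.clamp_mem

theorem Standing.continuous_argVar (hD : D.Standing) (hX : ContinuousOn X D.P)
    (hH : ContinuousOn H D.P) :
    Continuous fun q : (ℝ × (Fin n → ℝ)) × ℝ × ℝ => D.argVar X H q.1 q.2.1 q.2.2 := by
  have h1 := (hD.continuous_comp_clamp hX).comp
    (continuous_fst : Continuous (Prod.fst : (ℝ × (Fin n → ℝ)) × ℝ × ℝ → _))
  have h2 := (hD.continuous_comp_clamp hH).comp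
    (continuous_fst : Continuous (Prod.fst : (ℝ × (Fin n → ℝ)) × ℝ × ℝ → _))
  have h3 := continuous_clamp (D := D) |>.comp
    (continuous_fst : Continuous (Prod.fst : (ℝ × (Fin n → ℝ)) × ℝ × ℝ → _))
  have h4 : Continuous fun q : (ℝ × (Fin n → ℝ)) × ℝ × ℝ => q.2.1 := by fun_prop
  exact h3.fst.prodMk (h3.snd.prodMk ((h1.fst.add (h4.mul h2.fst)).prodMk
    ((h1.snd.fst.add (h4.mul h2.snd.fst)).prodMk ((h1.snd.snd.add (h4.smul h2.snd.snd)).prodMk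
      (by fun_prop)))))

theorem hasDerivAt_argVar (p : ℝ × (Fin n → ℝ)) (ε ζ : ℝ) :
    HasDerivAt (fun e => D.argVar X H p e ζ)
      (0, 0, (H (D.clamp p)).1, (H (D.clamp p)).2.1, (H (D.clamp p)).2.2, 0) ε := by
  have h : ∀ r r' : ℝ, HasDerivAt (fun e => r + e * r') r' ε := fun r r' => by
    simpa using ((hasDerivAt_id ε).mul_const r').const_add r
  refine (hasDerivAt_const _ _).prodMk ((hasDerivAt_const _ _).prodMk ((h _ _).prodMk
    ((h _ _).prodMk (HasDerivAt.prodMk ?_ (hasDerivAt_const _ _)))))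
  simpa using ((hasDerivAt_id ε).smul_const (H (D.clamp p)).2.2).const_add (X (D.clamp p)).2.2

variable (D) in
/-- Right-hand side of the Herglotz equation along `X + ε H`. -/
noncomputable def rhs (X H : ℝ × (Fin n → ℝ) → ℝ × ℝ × (Fin n → ℝ)) (t ε ζ : ℝ) : ℝ :=
  ∫ s in D.Ω, D.L (D.argVar X H (t, s) ε ζ)

variable (D) in
/-- Derivative of `rhs` in `ε`. -/
noncomputable def rhsVar (X H : ℝ × (Fin n → ℝ) → ℝ × ℝ × (Fin n → ℝ)) (t ε ζ : ℝ) : ℝ :=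
  ∫ s in D.Ω, D.dL (D.argVar X H (t, s) ε ζ) (0, 0, (H (D.clamp (t, s))).1,
    (H (D.clamp (t, s))).2.1, (H (D.clamp (t, s))).2.2, 0)

variable (D) in
/-- Derivative of `rhs` in `ζ`. -/
noncomputable def rhsZ (X H : ℝ × (Fin n → ℝ) → ℝ × ℝ × (Fin n → ℝ)) (t ε ζ : ℝ) : ℝ :=
  ∫ s in D.Ω, D.dL (D.argVar X H (t, s) ε ζ) (0, 0, 0, 0, 0, 1)

theorem Standing.continuous_L_argVar (hD : D.Standing) (hX : ContinuousOn X D.P)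
    (hH : ContinuousOn H D.P) :
    Continuous fun q : (ℝ × ℝ × ℝ) × (Fin n → ℝ) =>
      D.L (D.argVar X H (q.1.1, q.2) q.1.2.1 q.1.2.2) :=
  hD.continuousOn_L.comp_continuous ((hD.continuous_argVar hX hH).comp (by fun_prop :
    Continuous fun q : (ℝ × ℝ × ℝ) × (Fin n → ℝ) => ((q.1.1, q.2), q.1.2.1, q.1.2.2)))
    fun _ => hD.argVar_mem _ _ _

theorem Standing.continuous_dL_argVar (hD : D.Standing) (hX : ContinuousOn X D.P)
    (hH : ContinuousOn H D.P) :
    Continuous fun q : (ℝ × ℝ × ℝ) × (Fin n → ℝ) =>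
      D.dL (D.argVar X H (q.1.1, q.2) q.1.2.1 q.1.2.2) :=
  hD.continuousOn_dL.comp_continuous ((hD.continuous_argVar hX hH).comp (by fun_prop :
    Continuous fun q : (ℝ × ℝ × ℝ) × (Fin n → ℝ) => ((q.1.1, q.2), q.1.2.1, q.1.2.2)))
    fun _ => hD.argVar_mem _ _ _

theorem Standing.continuous_dL_argVar_var (hD : D.Standing) (hX : ContinuousOn X D.P)
    (hH : ContinuousOn H D.P) :
    Continuous fun q : (ℝ × ℝ × ℝ) × (Fin n → ℝ) =>
      D.dL (D.argVar X H (q.1.1, q.2) q.1.2.1 q.1.2.2) (0, 0, (H (D.clamp (q.1.1, q.2))).1,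
    (H (D.clamp (q.1.1, q.2))).2.1, (H (D.clamp (q.1.1, q.2))).2.2, 0) := by
  have h2 := (hD.continuous_comp_clamp hH).comp
    (by fun_prop : Continuous fun q : (ℝ × ℝ × ℝ) × (Fin n → ℝ) => (q.1.1, q.2))
  exact (hD.continuous_dL_argVar hX hH).clm_apply (continuous_const.prodMk
    (continuous_const.prodMk (h2.fst.prodMk (h2.snd.fst.prodMk (h2.snd.snd.prodMk
      continuous_const)))))

theorem Standing.continuous_rhs (hD : D.Standing) (hX : ContinuousOn X D.P)
    (hH : ContinuousOn H D.P) :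
    Continuous fun q : ℝ × ℝ × ℝ => D.rhs X H q.1 q.2.1 q.2.2 :=
  continuous_parametric_integral_of_continuous (hD.continuous_L_argVar hX hH) isCompact_Ω

theorem Standing.continuous_rhsVar (hD : D.Standing) (hX : ContinuousOn X D.P)
    (hH : ContinuousOn H D.P) :
    Continuous fun q : ℝ × ℝ × ℝ => D.rhsVar X H q.1 q.2.1 q.2.2 :=
  continuous_parametric_integral_of_continuous (hD.continuous_dL_argVar_var hX hH) isCompact_Ω

theorem Standing.continuous_rhsZ (hD : D.Standing) (hX : ContinuousOn X D.P)
    (hH : ContinuousOn H D.P) :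
    Continuous fun q : ℝ × ℝ × ℝ => D.rhsZ X H q.1 q.2.1 q.2.2 :=
  continuous_parametric_integral_of_continuous
    ((hD.continuous_dL_argVar hX hH).clm_apply continuous_const) isCompact_Ω

theorem Standing.hasDerivAt_rhs_var (hD : D.Standing) (hX : ContinuousOn X D.P)
    (hH : ContinuousOn H D.P) (t ε ζ : ℝ) :
    HasDerivAt (fun e => D.rhs X H t e ζ) (D.rhsVar X H t ε ζ) ε :=
  hasDerivAt_setIntegral_of_continuous (F := fun e s => D.L (D.argVar X H (t, s) e ζ))
    (F' := fun e s => D.dL (D.argVar X H (t, s) e ζ) (0, 0, (H (D.clamp (t, s))).1,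
      (H (D.clamp (t, s))).2.1, (H (D.clamp (t, s))).2.2, 0)) isCompact_Ω measurableSet_Ω
    ((hD.continuous_L_argVar hX hH).comp (by fun_prop :
      Continuous fun q : ℝ × (Fin n → ℝ) => ((t, q.1, ζ), q.2)))
    ((hD.continuous_dL_argVar_var hX hH).comp (by fun_prop :
      Continuous fun q : ℝ × (Fin n → ℝ) => ((t, q.1, ζ), q.2)))
    (fun e s => hD.hasDerivAt_L (hasDerivAt_argVar (t, s) e ζ) fun _ => hD.argVar_mem _ _ _) ε

theorem Standing.hasDerivAt_rhs_z (hD : D.Standing) (hX : ContinuousOn X D.P)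
    (hH : ContinuousOn H D.P) (t ε ζ : ℝ) :
    HasDerivAt (fun u => D.rhs X H t ε u) (D.rhsZ X H t ε ζ) ζ :=
  hasDerivAt_setIntegral_of_continuous (F := fun u s => D.L (D.argVar X H (t, s) ε u))
    (F' := fun u s => D.dL (D.argVar X H (t, s) ε u) (0, 0, 0, 0, 0, 1)) isCompact_Ω measurableSet_Ω
    ((hD.continuous_L_argVar hX hH).comp (by fun_prop :
      Continuous fun q : ℝ × (Fin n → ℝ) => ((t, ε, q.1), q.2)))
    (((hD.continuous_dL_argVar hX hH).clm_apply continuous_const).comp (by fun_prop :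
      Continuous fun q : ℝ × (Fin n → ℝ) => ((t, ε, q.1), q.2)))
    (fun u s => hasDerivAt_L_z hD (hD.clamp_mem (t, s)) u) ζ

end Variation

end Data

/-! ### The first variation. -/

/-- `deriv` is additive only where both functions are differentiable; at the end points it may be
meaningless, but these form a null set. -/
theorem combinedCaputo_add_mul {α β : ℝ → ℝ → ℝ} {γ : ℝ × ℝ} {c d t ε : ℝ} {f h : ℝ → ℝ}
    (hf : ∀ τ ∈ Ioo c d, DifferentiableAt ℝ f τ) (hh : ∀ τ ∈ Ioo c d, DifferentiableAt ℝ h τ)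
    (ht : t ∈ Icc c d) (ef : CombinedCaputoExists α β γ c d f t)
    (eh : CombinedCaputoExists α β γ c d h t)
    (es : CombinedCaputoExists α β γ c d (fun τ => f τ + ε * h τ) t) :
    combinedCaputo α β γ c d (fun τ => f τ + ε * h τ) t
      = combinedCaputo α β γ c d f t + ε * combinedCaputo α β γ c d h t := by
  rw [combinedCaputo_eq ht es, combinedCaputo_eq ht ef, combinedCaputo_eq ht eh,
    ← integral_const_mul, ← integral_add (ef.integrableOn ht) ((eh.integrableOn ht).const_mul ε)]
  refine integral_congr_ae ?_
  filter_upwards [ae_restrict_mem measurableSet_Icc, ae_restrict_of_ae (Measure.ae_ne volume c),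
    ae_restrict_of_ae (Measure.ae_ne volume d)] with τ hτ hc hd
  have hm : τ ∈ Ioo c d := ⟨lt_of_le_of_ne hτ.1 hc.symm, lt_of_le_of_ne hτ.2 hd⟩
  have hs : deriv (fun τ => f τ + ε * h τ) τ = deriv f τ + ε * deriv h τ :=
    ((hf τ hm).hasDerivAt.add ((hh τ hm).hasDerivAt.const_mul ε)).deriv
  rw [hs]
  ring

namespace Data

variable {n : ℕ} {D : Data n} {x y h : ℝ × (Fin n → ℝ) → ℝ} {z : ℝ → ℝ} {T : ℝ}

theorem update_mem_Ω {s : Fin n → ℝ} (hs : s ∈ D.Ω) {i : Fin n} {σ : ℝ}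
    (hσ : σ ∈ Icc (D.lo i) (D.hi i)) : Function.update s i σ ∈ D.Ω :=
  ⟨le_update_iff.2 ⟨hσ.1, fun j _ => hs.1 j⟩, update_le_iff.2 ⟨hσ.2, fun j _ => hs.2 j⟩⟩

theorem apply_mem_of_mem_Ω {s : Fin n → ℝ} (hs : s ∈ D.Ω) (i : Fin n) :
    s i ∈ Icc (D.lo i) (D.hi i) := ⟨hs.1 i, hs.2 i⟩

theorem differentiableAt_sectionT (hy : ContDiffOn ℝ 1 y D.P) {s : Fin n → ℝ} (hs : s ∈ D.Ω)
    {t : ℝ} (ht : t ∈ Ioo D.a D.b) : DifferentiableAt ℝ (fun τ => y (τ, s)) t :=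
  ((hy.differentiableOn one_ne_zero).comp (f := fun τ : ℝ => (τ, s)) (by fun_prop)
    fun _ hτ => ⟨hτ, hs⟩).differentiableAt (Icc_mem_nhds ht.1 ht.2)

theorem differentiableAt_sectionS (hy : ContDiffOn ℝ 1 y D.P) {p : ℝ × (Fin n → ℝ)}
    (hp : p ∈ D.P) {i : Fin n} {σ : ℝ} (hσ : σ ∈ Ioo (D.lo i) (D.hi i)) :
    DifferentiableAt ℝ (fun σ => y (p.1, Function.update p.2 i σ)) σ :=
  ((hy.differentiableOn one_ne_zero).comp (f := fun σ : ℝ => (p.1, Function.update p.2 i σ))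
    (fun σ _ => ((differentiableAt_const _).prodMk
      (hasDerivAt_update p.2 i σ).differentiableAt).differentiableWithinAt)
    fun _ hτ => ⟨hp.1, update_mem_Ω hp.2 hτ⟩).differentiableAt (Icc_mem_nhds hσ.1 hσ.2)

theorem contDiffOn_add_mul (hx : ContDiffOn ℝ 1 x D.P) (hh : ContDiffOn ℝ 1 h D.P) (ε : ℝ) :
    ContDiffOn ℝ 1 (fun p => x p + ε * h p) D.P := hx.add (contDiffOn_const.mul hh)

theorem Standing.capT_add_mul (hD : D.Standing) (hx : ContDiffOn ℝ 1 x D.P)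
    (hh : ContDiffOn ℝ 1 h D.P) (ε : ℝ) {p : ℝ × (Fin n → ℝ)} (hp : p ∈ D.P) :
    D.capT (fun p => x p + ε * h p) p = D.capT x p + ε * D.capT h p :=
  combinedCaputo_add_mul (fun _ hτ => differentiableAt_sectionT hx hp.2 hτ)
    (fun _ hτ => differentiableAt_sectionT hh hp.2 hτ) hp.1 ((hD.capT_cont x hx).1 p hp)
    ((hD.capT_cont h hh).1 p hp) ((hD.capT_cont _ (contDiffOn_add_mul hx hh ε)).1 p hp)

theorem Standing.capS_add_mul (hD : D.Standing) (i : Fin n) (hx : ContDiffOn ℝ 1 x D.P)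
    (hh : ContDiffOn ℝ 1 h D.P) (ε : ℝ) {p : ℝ × (Fin n → ℝ)} (hp : p ∈ D.P) :
    D.capS i (fun p => x p + ε * h p) p = D.capS i x p + ε * D.capS i h p :=
  combinedCaputo_add_mul (fun _ hτ => differentiableAt_sectionS hx hp hτ)
    (fun _ hτ => differentiableAt_sectionS hh hp hτ) (apply_mem_of_mem_Ω hp.2 i)
    ((hD.capS_cont i x hx).1 p hp) ((hD.capS_cont i h hh).1 p hp)
    ((hD.capS_cont i _ (contDiffOn_add_mul hx hh ε)).1 p hp)

/-- The kernel of the fractional derivative in `t` is uniformly integrable. -/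
theorem Standing.combKernelT (hD : D.Standing) :
    (∀ t ∈ Icc D.a D.b, IntegrableOn (combKernel D.α D.β D.γ t) (Icc D.a D.b)) ∧
    ∃ C, ∀ t ∈ Icc D.a D.b, ∫ τ in Icc D.a D.b, |combKernel D.α D.β D.γ t τ| ≤ C := by
  have hcd : ∀ y : ℝ → ℝ, ContDiff ℝ 1 y →
      ContDiffOn ℝ 1 (fun p : ℝ × (Fin n → ℝ) => y p.1) D.P := fun y hy =>
    (hy.comp contDiff_fst).contDiffOn
  refine exists_bound_combKernel hD.α_mem hD.β_mem hD.γ_mem.1.1 hD.γ_mem.2.1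
    (fun y hy t ht => (hD.capT_cont _ (hcd y hy)).1 (t, D.lo) ⟨ht, hD.lo_mem_Ω⟩) fun y hy => ?_
  obtain ⟨C, -, hC⟩ := exists_nonneg_bound_of_continuousOn isCompact_P
    (hD.capT_cont _ (hcd y hy)).2
  exact ⟨C, fun t ht => hC (t, D.lo) ⟨ht, hD.lo_mem_Ω⟩⟩

/-- The kernel of the fractional derivative in `sᵢ` is uniformly integrable. -/
theorem Standing.combKernelS (hD : D.Standing) (i : Fin n) :
    (∀ t ∈ Icc (D.lo i) (D.hi i),
      IntegrableOn (combKernel (D.αs i) (D.βs i) (D.γs i) t) (Icc (D.lo i) (D.hi i))) ∧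
    ∃ C, ∀ t ∈ Icc (D.lo i) (D.hi i),
      ∫ τ in Icc (D.lo i) (D.hi i), |combKernel (D.αs i) (D.βs i) (D.γs i) t τ| ≤ C := by
  have hcd : ∀ y : ℝ → ℝ, ContDiff ℝ 1 y →
      ContDiffOn ℝ 1 (fun p : ℝ × (Fin n → ℝ) => y (p.2 i)) D.P := fun y hy =>
    (hy.comp ((contDiff_apply ℝ ℝ i).comp contDiff_snd)).contDiffOn
  have hm : ∀ σ ∈ Icc (D.lo i) (D.hi i), (D.a, Function.update D.lo i σ) ∈ D.P := fun σ hσ =>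
    ⟨left_mem_Icc.2 hD.a_lt_b.le, update_mem_Ω hD.lo_mem_Ω hσ⟩
  refine exists_bound_combKernel (hD.αs_mem i) (hD.βs_mem i) (hD.γs_mem i).1.1 (hD.γs_mem i).2.1
    (fun y hy t ht => ?_) fun y hy => ?_
  · simpa using (hD.capS_cont i _ (hcd y hy)).1 _ (hm t ht)
  · obtain ⟨C, -, hC⟩ := exists_nonneg_bound_of_continuousOn isCompact_P
      (hD.capS_cont i _ (hcd y hy)).2
    exact ⟨C, fun t ht => by simpa [capS] using hC _ (hm t ht)⟩

variable (D) in
/-- A trajectory with its fractional derivatives. -/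
noncomputable def jet (y : ℝ × (Fin n → ℝ) → ℝ) (p : ℝ × (Fin n → ℝ)) : ℝ × ℝ × (Fin n → ℝ) :=
  (y p, D.capT y p, fun i => D.capS i y p)

theorem Standing.continuousOn_jet (hD : D.Standing) (hy : ContDiffOn ℝ 1 y D.P) :
    ContinuousOn (D.jet y) D.P :=
  hy.continuousOn.prodMk ((hD.capT_cont y hy).2.prodMk
    (continuousOn_pi.2 fun i => (hD.capS_cont i y hy).2))

/-- By linearity of the Caputo derivatives, moving the jet affinely amounts to moving the
trajectory, so `rhs` is the genuine Herglotz right-hand side of `x + ε h`. -/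
theorem Standing.argVar_jet (hD : D.Standing) (hx : ContDiffOn ℝ 1 x D.P)
    (hh : ContDiffOn ℝ 1 h D.P) (ε : ℝ) (z : ℝ → ℝ) {p : ℝ × (Fin n → ℝ)} (hp : p ∈ D.P) :
    D.argVar (D.jet x) (D.jet h) p ε (z p.1) = D.arg (fun p => x p + ε * h p) z p := by
  have h2 : (fun i => D.capS i (fun p => x p + ε * h p) p)
      = (fun i => D.capS i x p) + ε • fun i => D.capS i h p := by
    ext i
    exact hD.capS_add_mul i hx hh ε hp
  rw [arg, h2, hD.capT_add_mul hx hh ε hp, argVar, clamp_of_mem hp]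
  rfl

theorem Standing.argVar_jet_zero (hD : D.Standing) (hx : ContDiffOn ℝ 1 x D.P)
    (hh : ContDiffOn ℝ 1 h D.P) (z : ℝ → ℝ) {p : ℝ × (Fin n → ℝ)} (hp : p ∈ D.P) :
    D.argVar (D.jet x) (D.jet h) p 0 (z p.1) = D.arg x z p := by
  rw [hD.argVar_jet hx hh 0 z hp]
  simp

theorem Standing.rhs_jet (hD : D.Standing) (hx : ContDiffOn ℝ 1 x D.P)
    (hh : ContDiffOn ℝ 1 h D.P) (ε : ℝ) (z : ℝ → ℝ) {t : ℝ} (ht : t ∈ Icc D.a D.b) :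
    D.rhs (D.jet x) (D.jet h) t ε (z t)
      = ∫ s in D.Ω, D.L (D.arg (fun p => x p + ε * h p) z (t, s)) :=
  setIntegral_congr_fun measurableSet_Ω fun s hs =>
    congrArg D.L (hD.argVar_jet hx hh ε z (p := (t, s)) ⟨ht, hs⟩)

theorem Standing.rhsZ_jet (hD : D.Standing) (hx : ContDiffOn ℝ 1 x D.P)
    (hh : ContDiffOn ℝ 1 h D.P) (z : ℝ → ℝ) {t : ℝ} (ht : t ∈ Icc D.a D.b) :
    D.rhsZ (D.jet x) (D.jet h) t 0 (z t)
      = ∫ s in D.Ω, partialZ D.L (D.arg x z (t, s)) :=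
  setIntegral_congr_fun measurableSet_Ω fun s hs => by
    rw [hD.argVar_jet_zero hx hh z (p := (t, s)) ⟨ht, hs⟩]
    exact (partialZ_eq hD ⟨ht, hs⟩).symm

theorem Standing.rhsVar_jet (hD : D.Standing) (hx : ContDiffOn ℝ 1 x D.P)
    (hh : ContDiffOn ℝ 1 h D.P) (z : ℝ → ℝ) {t : ℝ} (ht : t ∈ Icc D.a D.b) :
    D.rhsVar (D.jet x) (D.jet h) t 0 (z t)
      = ∫ s in D.Ω, (h (t, s) * partialX D.L (D.arg x z (t, s))
        + D.capT h (t, s) * partialV D.L (D.arg x z (t, s))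
        + ∑ i, D.capS i h (t, s) * partialW D.L i (D.arg x z (t, s))) :=
  setIntegral_congr_fun measurableSet_Ω fun s hs => by
    have hp : (t, s) ∈ D.P := ⟨ht, hs⟩
    rw [hD.argVar_jet_zero hx hh z hp, clamp_of_mem hp]
    exact dL_apply hD hp _ _ _

theorem Admissible.continuousOn_z (hA : D.Admissible x z T) : ContinuousOn z (Icc D.a D.b) :=
  fun t ht => (hA.ode t ht).continuousWithinAt

theorem Standing.continuousOn_arg (hD : D.Standing) (hA : D.Admissible x z T) :
    ContinuousOn (D.arg x z) D.P := by
  have hj := hD.continuousOn_jet hA.contDiff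
  exact continuousOn_fst.prodMk (continuousOn_snd.prodMk (hj.fst.prodMk (hj.snd.fst.prodMk
    (hj.snd.snd.prodMk (hA.continuousOn_z.comp continuousOn_fst fun _ hp => hp.1)))))

theorem mapsTo_arg : MapsTo (D.arg x z) D.P D.argSet := fun _ hp => hp

theorem Standing.hasDerivWithinAt_mult (hD : D.Standing) (hA : D.Admissible x z T) {t : ℝ}
    (ht : t ∈ Icc D.a D.b) :
    HasDerivWithinAt (D.mult x z)
      (-(∫ s in D.Ω, partialZ D.L (D.arg x z (t, s))) * D.mult x z t) (Icc D.a D.b) t := by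
  have hx := hA.contDiff
  have hc : ContinuousOn (fun t => ∫ s in D.Ω, partialZ D.L (D.arg x z (t, s)))
      (Icc D.a D.b) := by
    refine ContinuousOn.congr ?_ fun t ht => (hD.rhsZ_jet hx hx z ht).symm
    exact (hD.continuous_rhsZ (hD.continuousOn_jet hx) (hD.continuousOn_jet hx)).comp_continuousOn
      (continuousOn_id.prodMk (continuousOn_const.prodMk hA.continuousOn_z))
  have : Fact (t ∈ Icc D.a D.b) := ⟨ht⟩
  have h1 := intervalIntegral.integral_hasDerivWithinAt_right (s := Icc D.a D.b)
      (t := Icc D.a D.b)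
      ((hc.mono (Icc_subset_Icc_right ht.2)).intervalIntegrable_of_Icc ht.1)
      (hc.stronglyMeasurableAtFilter_nhdsWithin measurableSet_Icc t) (hc t ht)
  exact h1.neg.exp.congr_deriv (by rw [mul_comm]; rfl)

theorem Standing.continuousOn_mult (hD : D.Standing) (hA : D.Admissible x z T) :
    ContinuousOn (D.mult x z) (Icc D.a D.b) :=
  fun _ ht => (hD.hasDerivWithinAt_mult hA ht).continuousWithinAt

theorem Standing.continuousOn_mult_fst (hD : D.Standing) (hA : D.Admissible x z T) :
    ContinuousOn (fun p : ℝ × (Fin n → ℝ) => D.mult x z p.1) D.P :=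
  (hD.continuousOn_mult hA).comp continuousOn_fst fun _ hp => hp.1

theorem Standing.continuousOn_momT (hD : D.Standing) (hA : D.Admissible x z T) :
    ContinuousOn (D.momT x z) D.P :=
  (hD.continuousOn_mult_fst hA).mul
    (hD.continuousOn_partialV.comp (hD.continuousOn_arg hA) mapsTo_arg)

theorem Standing.continuousOn_momS (hD : D.Standing) (hA : D.Admissible x z T) (i : Fin n) :
    ContinuousOn (D.momS i x z) D.P :=
  (hD.continuousOn_mult_fst hA).mul
    ((hD.continuousOn_partialW i).comp (hD.continuousOn_arg hA) mapsTo_arg)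

theorem Standing.continuousOn_momX (hD : D.Standing) (hA : D.Admissible x z T) :
    ContinuousOn (fun p => partialX D.L (D.arg x z p) * D.mult x z p.1) D.P :=
  (hD.continuousOn_partialX.comp (hD.continuousOn_arg hA) mapsTo_arg).mul
    (hD.continuousOn_mult_fst hA)

/-- The first variation of the terminal value vanishes at an extremizer. -/
theorem Standing.first_variation (hD : D.Standing) (hext : D.IsExtremizer x z T)
    (hh : ContDiffOn ℝ 1 h D.P) (h0 : ∀ p ∈ frontier D.P, h p = 0) :
    ∫ τ in D.a..T, D.mult x z τ * D.rhsVar (D.jet x) (D.jet h) τ 0 (z τ) = 0 := by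
  obtain ⟨hA, δ, hδ, hmin⟩ := hext
  have hx := hA.contDiff
  have hX := hD.continuousOn_jet hx
  have hH := hD.continuousOn_jet hh
  have hz : ∀ t ∈ Icc D.a D.b,
      HasDerivWithinAt z (D.rhs (D.jet x) (D.jet h) t 0 (z t)) (Icc D.a D.b) t := fun t ht => by
    rw [hD.rhs_jet hx hh 0 z ht]
    simpa using hA.ode t ht
  obtain ⟨ε₀, hε₀, C, hC, w, hw⟩ := exists_perturbed_solutions hD.a_lt_b.le
    (hD.continuous_rhs hX hH) (hD.continuous_rhsVar hX hH) (hD.continuous_rhsZ hX hH)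
    (hD.hasDerivAt_rhs_var hX hH) (hD.hasDerivAt_rhs_z hX hH) hz
  have hder := hasDerivAt_perturbed_solutions
    (hD.continuous_rhsVar hX hH) (hD.continuous_rhsZ hX hH)
    (hD.hasDerivAt_rhs_var hX hH) (hD.hasDerivAt_rhs_z hX hH) hz hε₀ hC (fun ε h => (hw ε h).1)
    (fun ε h => (hw ε h).2.1) (fun ε h => (hw ε h).2.2) hA.mem (hD.continuousOn_mult hA)
    (fun t ht => by
      rw [hD.rhsZ_jet hx hh z ht]
      exact hD.hasDerivWithinAt_mult hA ht)
  have hw0 : w 0 T = z T := by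
    have := (hw 0 (by simpa using hε₀.le)).2.2 T hA.mem
    rw [abs_zero, mul_zero] at this
    exact sub_eq_zero.1 (abs_nonpos_iff.1 this)
  obtain ⟨N, hN⟩ := isCompact_P.exists_bound_of_continuousOn hH
  have hev : ∀ᶠ ε : ℝ in nhds 0, D.Admissible (fun p => x p + ε * h p) (w ε) T ∧
      D.Near δ x T (fun p => x p + ε * h p) T := by
    -- `N` bounds `h` and all its Caputo derivatives on `P`, so such `ε` keep the variation within
    -- `δ`.
    have hpos : 0 < min ε₀ (δ / (|N| + 1)) := by positivity
    filter_upwards [Metric.ball_mem_nhds (0 : ℝ) hpos] with ε hε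
    rw [mem_ball_zero_iff, Real.norm_eq_abs, lt_min_iff] at hε
    obtain ⟨w1, w2, -⟩ := hw ε hε.1.le
    refine ⟨⟨contDiffOn_add_mul hx hh ε, fun p hp => ?_, w1.trans hA.initial, fun t ht => ?_,
      hA.mem⟩, ?_, fun p hp => ?_⟩
    · rw [h0 p hp, mul_zero, add_zero, hA.boundary p hp]
    · rw [← hD.rhs_jet hx hh ε (w ε) ht]
      exact w2 t ht
    · simpa using hδ
    · have hb : ∀ r : ℝ, |r| ≤ ‖D.jet h p‖ → |ε * r| < δ := fun r hr => by
        rw [abs_mul]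
        calc |ε| * |r| ≤ |ε| * (|N| + 1) := by
              gcongr
              have := hr.trans ((hN p hp).trans (le_abs_self N))
              linarith
          _ < δ := (lt_div_iff₀ (by positivity)).1 hε.2
      have j1 : |h p| ≤ ‖D.jet h p‖ := norm_fst_le (D.jet h p)
      have j2 : |D.capT h p| ≤ ‖D.jet h p‖ :=
        (norm_fst_le (D.jet h p).2).trans (norm_snd_le (D.jet h p))
      have j3 : ∀ i, |D.capS i h p| ≤ ‖D.jet h p‖ := fun i =>
        (norm_le_pi_norm (D.jet h p).2.2 i).trans
          ((norm_snd_le (D.jet h p).2).trans (norm_snd_le (D.jet h p)))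
      refine ⟨?_, ?_, fun i => ?_⟩
      · rw [add_sub_cancel_left]; exact hb _ j1
      · rw [hD.capT_add_mul hx hh ε hp, add_sub_cancel_left]; exact hb _ j2
      · rw [hD.capS_add_mul i hx hh ε hp, add_sub_cancel_left]; exact hb _ (j3 i)
  -- Multiplication by `λ(T)` preserves the inequality, so `λ(T) w ε T` also has a local extremum at
  -- `ε = 0`.
  have hmult : 0 ≤ D.mult x z T := (Real.exp_pos _).le
  rcases hmin with hmin | hmax
  · refine IsLocalMin.hasDerivAt_eq_zero (f := fun ε => D.mult x z T * w ε T) ?_ hder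
    filter_upwards [hev] with ε hε
    rw [hw0]
    exact mul_le_mul_of_nonneg_left (hmin _ _ _ hε.1 hε.2) hmult
  · refine IsLocalMax.hasDerivAt_eq_zero (f := fun ε => D.mult x z T * w ε T) ?_ hder
    filter_upwards [hev] with ε hε
    rw [hw0]
    exact mul_le_mul_of_nonneg_left (hmax _ _ _ hε.1 hε.2) hmult

/-- The integrated Lagrangian vanishes at an extremal terminal time in the interior. -/
theorem IsExtremizer.integral_L_eq_zero (hext : D.IsExtremizer x z T) (haT : D.a < T)
    (hTb : T < D.b) : ∫ s in D.Ω, D.L (D.arg x z (T, s)) = 0 := by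
  obtain ⟨hA, δ, hδ, hmin⟩ := hext
  have hd := (hA.ode T hA.mem).hasDerivAt (Icc_mem_nhds haT hTb)
  -- The equation for `z` holds on all of `[a, b]`, so the same `x` and `z` stay admissible when `T`
  -- alone moves.
  have hev : ∀ᶠ T' in nhds T, D.Admissible x z T' ∧ D.Near δ x T x T' := by
    filter_upwards [Icc_mem_nhds haT hTb, Metric.ball_mem_nhds T hδ] with T' h1 h2
    exact ⟨{ hA with mem := h1 }, h2, fun p _ => by simp [hδ]⟩
  rcases hmin with hmin | hmax
  · refine IsLocalMin.hasDerivAt_eq_zero ?_ hd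
    filter_upwards [hev] with T' h using hmin _ _ _ h.1 h.2
  · refine IsLocalMax.hasDerivAt_eq_zero ?_ hd
    filter_upwards [hev] with T' h using hmax _ _ _ h.1 h.2

end Data

/-! ### Integration over boxes and the fundamental lemma. -/

theorem setIntegral_prod_of_continuousOn {m : ℕ} {A : Set ℝ} {B : Set (Fin m → ℝ)}
    (hA : IsCompact A) (hB : IsCompact B) {F : ℝ × (Fin m → ℝ) → ℝ}
    (hF : ContinuousOn F (A ×ˢ B)) :
    ∫ p in A ×ˢ B, F p = ∫ t in A, ∫ s in B, F (t, s) :=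
  setIntegral_prod F (hF.integrableOn_compact (hA.prod hB))

theorem setIntegral_prod_symm_of_continuousOn {m : ℕ} {A : Set ℝ} {B : Set (Fin m → ℝ)}
    (hA : IsCompact A) (hB : IsCompact B) {F : ℝ × (Fin m → ℝ) → ℝ}
    (hF : ContinuousOn F (A ×ˢ B)) :
    ∫ p in A ×ˢ B, F p = ∫ s in B, ∫ t in A, F (t, s) := by
  have h : IntegrableOn F (A ×ˢ B) := hF.integrableOn_compact (hA.prod hB)
  rw [IntegrableOn, Measure.volume_eq_prod, ← Measure.prod_restrict] at h
  rw [Measure.volume_eq_prod, ← Measure.prod_restrict, integral_prod_symm F h]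

theorem setIntegral_add_add_sum {X : Type*} [TopologicalSpace X] [T2Space X] [MeasurableSpace X]
    [OpensMeasurableSpace X] {μ : Measure X} [IsFiniteMeasureOnCompacts μ] {K : Set X}
    (hK : IsCompact K) {ι : Type*} [Fintype ι] {A B : X → ℝ} {C : ι → X → ℝ}
    (hA : ContinuousOn A K) (hB : ContinuousOn B K) (hC : ∀ i, ContinuousOn (C i) K) :
    ∫ p in K, (A p + B p + ∑ i, C i p) ∂μ
      = (∫ p in K, A p ∂μ) + (∫ p in K, B p ∂μ) + ∑ i, ∫ p in K, C i p ∂μ := by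
  have h1 : ∫ p in K, (A p + B p + ∑ i, C i p) ∂μ
      = (∫ p in K, (A p + B p) ∂μ) + ∫ p in K, ∑ i, C i p ∂μ :=
    integral_add ((hA.add hB).integrableOn_compact hK)
      ((continuousOn_finsetSum _ fun i _ => hC i).integrableOn_compact hK)
  rw [h1, integral_add (hA.integrableOn_compact hK) (hB.integrableOn_compact hK),
    integral_finsetSum _ fun i _ => (hC i).integrableOn_compact hK]

theorem setIntegral_Icc_eq_insertNth {m : ℕ} {lo hi : Fin (m + 1) → ℝ} (i : Fin (m + 1))
    {F : (Fin (m + 1) → ℝ) → ℝ} (hF : ContinuousOn F (Icc lo hi)) :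
    ∫ s in Icc lo hi, F s = ∫ s' in Icc (i.removeNth lo) (i.removeNth hi),
      ∫ σ in Icc (lo i) (hi i), F (i.insertNth σ s') := by
  have hpre : (MeasurableEquiv.piFinSuccAbove (fun _ => ℝ) i).symm ⁻¹' Icc lo hi
      = Icc (lo i) (hi i) ×ˢ Icc (i.removeNth lo) (i.removeNth hi) := by
    ext q
    change lo ≤ i.insertNth q.1 q.2 ∧ i.insertNth q.1 q.2 ≤ hi ↔ _
    rw [Fin.insertNth_le_iff, Fin.le_insertNth_iff]
    exact ⟨fun h => ⟨⟨h.1.1, h.2.1⟩, h.1.2, h.2.2⟩, fun h => ⟨⟨h.1.1, h.2.1⟩, h.1.2, h.2.2⟩⟩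
  have hins : Continuous fun q : ℝ × (Fin m → ℝ) => (i.insertNth q.1 q.2 : Fin (m + 1) → ℝ) :=
    Continuous.finInsertNth i continuous_fst continuous_snd
  rw [← (volume_preserving_piFinSuccAbove (fun _ : Fin (m + 1) => ℝ) i).symm.setIntegral_preimage_emb
    (MeasurableEquiv.measurableEmbedding _) F, hpre]
  exact setIntegral_prod_symm_of_continuousOn isCompact_Icc isCompact_Icc
    (hF.comp hins.continuousOn fun q hq => by rw [← hpre] at hq; exact hq)

/-- Fubini along coordinate `i`: reduces the integration by parts in `sᵢ` to one dimension. -/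
theorem setIntegral_Icc_congr_of_lines {n : ℕ} {lo hi : Fin n → ℝ} (hle : lo ≤ hi) (i : Fin n)
    {F G : (Fin n → ℝ) → ℝ} (hF : ContinuousOn F (Icc lo hi)) (hG : ContinuousOn G (Icc lo hi))
    (h : ∀ s ∈ Icc lo hi, ∫ σ in Icc (lo i) (hi i), F (Function.update s i σ)
      = ∫ σ in Icc (lo i) (hi i), G (Function.update s i σ)) :
    ∫ s in Icc lo hi, F s = ∫ s in Icc lo hi, G s := by
  obtain _ | m := n
  · exact i.elim0
  rw [setIntegral_Icc_eq_insertNth i hF, setIntegral_Icc_eq_insertNth i hG]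
  refine setIntegral_congr_fun measurableSet_Icc fun s' hs' => ?_
  have := h (i.insertNth (lo i) s')
    ⟨Fin.le_insertNth_iff.2 ⟨le_rfl, hs'.1⟩, Fin.insertNth_le_iff.2 ⟨hle i, hs'.2⟩⟩
  simpa only [Fin.update_insertNth] using this

/-- Fundamental lemma of the calculus of variations, up to the boundary. -/
theorem eq_zero_of_forall_integral_mul_eq_zero {E : Type*} [NormedAddCommGroup E]
    [NormedSpace ℝ E] [FiniteDimensional ℝ E] [MeasurableSpace E] [BorelSpace E] {μ : Measure E}
    [IsFiniteMeasureOnCompacts μ] [μ.IsOpenPosMeasure] {U K : Set E} (hU : IsOpen U)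
    (hK : IsCompact K) (hUK : U ⊆ K) (hKU : K ⊆ closure U) {F : E → ℝ} (hF : ContinuousOn F K)
    (h : ∀ g : E → ℝ, ContDiff ℝ 1 g → (∀ p, p ∉ U → g p = 0) → ∫ p in K, g p * F p ∂μ = 0) :
    ∀ p ∈ K, F p = 0 := by
  have hint : IntegrableOn F U μ := (hF.integrableOn_compact hK).mono_set hUK
  have hae : ∀ᵐ p ∂μ, p ∈ U → F p = 0 := by
    refine hU.ae_eq_zero_of_integral_contDiff_smul_eq_zero hint.locallyIntegrableOn
      fun g hg _ hs => ?_
    have hg0 : ∀ p, p ∉ U → g p = 0 := fun p hp => image_eq_zero_of_notMem_tsupport fun h' =>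
      hp (hs h')
    rw [← h g (hg.of_le (by exact_mod_cast le_top)) hg0]
    refine (setIntegral_eq_integral_of_forall_compl_eq_zero fun p hp => ?_).symm
    rw [hg0 p fun hpU => hp (hUK hpU), zero_smul]
  -- Almost everywhere becomes everywhere on `U` by continuity, then on `K` because `U` is dense in
  -- it.
  have hon : EqOn F (fun _ => 0) U :=
    Measure.eqOn_open_of_ae_eq ((ae_restrict_iff' hU.measurableSet).2 hae) hU (hF.mono hUK)
      continuousOn_const
  exact fun p hp => hon.of_subset_closure hF continuousOn_const hUK hKU hp

theorem setIntegral_abs_mono {m : ℝ → ℝ} {A B : Set ℝ} {C : ℝ} (hAB : A ⊆ B)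
    (hi : IntegrableOn m B) (hb : ∫ τ in B, |m τ| ≤ C) : ∫ τ in A, |m τ| ≤ C :=
  (setIntegral_mono_set hi.abs (Filter.Eventually.of_forall fun _ => abs_nonneg _)
    (Filter.Eventually.of_forall hAB)).trans hb

theorem deriv_eq_zero_of_eqOn_zero {g : ℝ → ℝ} {V : Set ℝ} (hV : IsOpen V)
    (h : ∀ t ∈ V, g t = 0) {t : ℝ} (ht : t ∈ V) : deriv g t = 0 := by
  have : g =ᶠ[nhds t] fun _ => 0 := by
    filter_upwards [hV.mem_nhds ht] with τ hτ using h τ hτ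
  rw [this.deriv_eq, deriv_const]

/-! ### Fractional integration by parts on the box and the Euler–Lagrange equations. -/

namespace Data

variable {n : ℕ} {D : Data n} {x y h : ℝ × (Fin n → ℝ) → ℝ} {z : ℝ → ℝ} {T : ℝ}

theorem Standing.Ω_subset_closure (hD : D.Standing) : D.Ω ⊆ closure (interior D.Ω) := by
  rw [interior_Ω, closure_pi_set]
  simp_rw [closure_Ioo (hD.lo_lt_hi _).ne, pi_univ_Icc]
  exact subset_rfl

/-- Applied with `[c, d]` equal to `[a, T]` or `[T, b]`: the test functions then vanish on the
boundary of `P` and are legitimate variations. -/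
theorem Standing.eq_zero_of_forall_variation (hD : D.Standing) {c d : ℝ} (hcd : c < d)
    {F : ℝ × (Fin n → ℝ) → ℝ} (hF : ContinuousOn F (Icc c d ×ˢ D.Ω))
    (h : ∀ g : ℝ × (Fin n → ℝ) → ℝ, ContDiff ℝ 1 g →
      (∀ p, p ∉ Ioo c d ×ˢ interior D.Ω → g p = 0) → ∫ p in Icc c d ×ˢ D.Ω, g p * F p = 0) :
    ∀ p ∈ Icc c d ×ˢ D.Ω, F p = 0 :=
  eq_zero_of_forall_integral_mul_eq_zero (isOpen_Ioo.prod isOpen_interior)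
    (isCompact_Icc.prod isCompact_Ω) (prod_mono Ioo_subset_Icc_self interior_subset)
    (by
      rw [closure_prod_eq, closure_Ioo hcd.ne]
      exact prod_mono subset_rfl hD.Ω_subset_closure) hF h

theorem eq_zero_on_frontier {c d : ℝ} (hac : D.a ≤ c) (hdb : d ≤ D.b)
    (h0 : ∀ p, p ∉ Ioo c d ×ˢ interior D.Ω → h p = 0) : ∀ p ∈ frontier D.P, h p = 0 := by
  refine fun p hp => h0 p fun hpU => hp.2 ?_
  rw [P, interior_prod_eq, interior_Icc]
  exact ⟨Ioo_subset_Ioo hac hdb hpU.1, hpU.2⟩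

theorem contDiff_sectionT (hh : ContDiff ℝ 1 h) (s : Fin n → ℝ) :
    ContDiff ℝ 1 fun τ => h (τ, s) := hh.comp (contDiff_id.prodMk contDiff_const)

theorem contDiff_sectionS (hh : ContDiff ℝ 1 h) (t : ℝ) (s : Fin n → ℝ) (i : Fin n) :
    ContDiff ℝ 1 fun σ => h (t, Function.update s i σ) :=
  hh.comp (contDiff_const.prodMk (contDiff_update 1 s i))

theorem Icc_prod_subset_P (hT : T ≤ D.b) : Icc D.a T ×ˢ D.Ω ⊆ D.P :=
  prod_mono (Icc_subset_Icc_right hT) subset_rfl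

theorem Standing.first_variation_prod (hD : D.Standing) (hext : D.IsExtremizer x z T)
    (hh : ContDiffOn ℝ 1 h D.P) (h0 : ∀ p ∈ frontier D.P, h p = 0) :
    (∫ p in Icc D.a T ×ˢ D.Ω, h p * (partialX D.L (D.arg x z p) * D.mult x z p.1))
      + (∫ p in Icc D.a T ×ˢ D.Ω, D.momT x z p * D.capT h p)
      + ∑ i, ∫ p in Icc D.a T ×ˢ D.Ω, D.momS i x z p * D.capS i h p = 0 := by
  have hA := hext.1
  have hsub : Icc D.a T ×ˢ D.Ω ⊆ D.P := Icc_prod_subset_P hA.mem.2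
  have hc : IsCompact (Icc D.a T ×ˢ D.Ω) := isCompact_Icc.prod isCompact_Ω
  have c1 : ContinuousOn (fun p => h p * (partialX D.L (D.arg x z p) * D.mult x z p.1))
      (Icc D.a T ×ˢ D.Ω) := (hh.continuousOn.mul (hD.continuousOn_momX hA)).mono hsub
  have c2 : ContinuousOn (fun p => D.momT x z p * D.capT h p) (Icc D.a T ×ˢ D.Ω) :=
    ((hD.continuousOn_momT hA).mul (hD.capT_cont h hh).2).mono hsub
  have c3 : ∀ i, ContinuousOn (fun p => D.momS i x z p * D.capS i h p) (Icc D.a T ×ˢ D.Ω) :=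
    fun i => ((hD.continuousOn_momS hA i).mul (hD.capS_cont i h hh).2).mono hsub
  have c4 : ContinuousOn (fun p => h p * (partialX D.L (D.arg x z p) * D.mult x z p.1)
      + D.momT x z p * D.capT h p + ∑ i, D.momS i x z p * D.capS i h p) (Icc D.a T ×ˢ D.Ω) :=
    (c1.add c2).add (continuousOn_finsetSum _ fun i _ => c3 i)
  rw [← setIntegral_add_add_sum hc c1 c2 c3,
    setIntegral_prod_of_continuousOn isCompact_Icc isCompact_Ω c4,
    ← hD.first_variation hext hh h0, intervalIntegral.integral_of_le hA.mem.1,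
    integral_Icc_eq_integral_Ioc]
  refine setIntegral_congr_fun measurableSet_Ioc fun t ht => ?_
  rw [hD.rhsVar_jet hA.contDiff hh z ⟨ht.1.le, ht.2.trans hA.mem.2⟩, ← integral_const_mul]
  congr with s
  simp only [momT, momS]
  rw [mul_add, mul_add, Finset.mul_sum]
  congr 1
  · ring
  · exact Finset.sum_congr rfl fun i _ => by ring

/-- Fractional integration by parts in `t`, for variations supported in `[a, T]`. -/
theorem Standing.integral_momT_mul_capT (hD : D.Standing) (hA : D.Admissible x z T)
    (hT : D.a < T) (hreg : D.Regular x z T) (hh : ContDiff ℝ 1 h)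
    (h0 : ∀ p, p ∉ Ioo D.a T ×ˢ interior D.Ω → h p = 0) :
    ∫ p in Icc D.a T ×ˢ D.Ω, D.momT x z p * D.capT h p
      = ∫ p in Icc D.a T ×ˢ D.Ω, h p * D.dualMomT T x z p := by
  have hTb := hA.mem.2
  have hsub : Icc D.a T ×ˢ D.Ω ⊆ D.P := Icc_prod_subset_P hTb
  have hss : Icc D.a T ⊆ Icc D.a D.b := Icc_subset_Icc_right hTb
  have hcap := hD.capT_cont h hh.contDiffOn
  obtain ⟨hi, C, hb⟩ := hD.combKernelT
  rw [setIntegral_prod_symm_of_continuousOn (F := fun p => D.momT x z p * D.capT h p)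
      isCompact_Icc isCompact_Ω (((hD.continuousOn_momT hA).mul hcap.2).mono hsub),
    setIntegral_prod_symm_of_continuousOn (F := fun p => h p * D.dualMomT T x z p)
      isCompact_Icc isCompact_Ω (hh.continuous.continuousOn.mul hreg.dual)]
  refine setIntegral_congr_fun measurableSet_Ω fun s hs => ?_
  have hsec : ContinuousOn (fun τ : ℝ => (τ, s)) (Icc D.a T) := by fun_prop
  have hout : ∀ t, t ∉ Ioo D.a T → h (t, s) = 0 := fun t ht => h0 _ fun hm => ht hm.1
  have hdc : ContinuousOn (fun t => D.dualMomT T x z (t, s)) (Icc D.a T) :=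
    hreg.dual.comp hsec fun t ht => ⟨ht, hs⟩
  have key : ∫ t in Icc D.a T, D.momT x z (t, s) * ∫ τ in Icc D.a T,
      combKernel D.α D.β D.γ t τ * deriv (fun τ => h (τ, s)) τ
      = ∫ t in Icc D.a T, h (t, s) * D.dualMomT T x z (t, s) :=
    integral_mul_combKernel_deriv (γ := D.γ) (f := fun τ => D.momT x z (τ, s))
    (h := fun τ => h (τ, s)) hT.le hD.α_meas hD.β_meas
    (fun t ht => (hi t (hss ht)).mono_set hss)
    (fun t ht => setIntegral_abs_mono hss (hi t (hss ht)) (hb t (hss ht)))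
    ((hD.continuousOn_momT hA).comp hsec fun t ht => ⟨hss ht, hs⟩)
    (contDiff_sectionT hh s) (hout _ fun hm => lt_irrefl _ hm.1)
    (hout _ fun hm => lt_irrefl _ hm.2) (fun hγ => hreg.right hγ s hs)
    -- A left integral does not depend on the right end of the interval, so regularity on `[a, b]`
    -- restricts to `[a, T]`.
    (fun hγ => by
      obtain ⟨e1, e2⟩ := (hreg.left hγ).1 s hs
      exact ⟨fun t ht => e1 t (hss ht), e2.mono hss⟩)
    hdc
  refine Eq.trans (setIntegral_congr_fun measurableSet_Icc fun t ht => ?_) key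
  congr 1
  have ht' : (t, s) ∈ D.P := ⟨hss ht, hs⟩
  rw [capT, combinedCaputo_eq ht'.1 (hcap.1 _ ht')]
  -- The derivative of `h` vanishes beyond `T`, so the inner integral over `[a, b]` stops at `T`.
  refine (setIntegral_eq_of_subset_of_forall_sdiff_eq_zero measurableSet_Icc hss
    fun τ hτ => ?_)
  have hτT : τ ∈ Ioi T := lt_of_not_ge fun hle => hτ.2 ⟨hτ.1.1, hle⟩
  rw [deriv_eq_zero_of_eqOn_zero isOpen_Ioi (fun r hr => hout r fun hm => hm.2.not_gt hr) hτT,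
    mul_zero]

/-- Fractional integration by parts in `t`, for variations supported in `[T, b]`. -/
theorem Standing.integral_momT_mul_capT_tail (hD : D.Standing) (hA : D.Admissible x z T)
    (hreg : D.Regular x z T) (hγ : D.γ.2 ≠ 0) (hh : ContDiff ℝ 1 h)
    (h0 : ∀ p, p ∉ Ioo T D.b ×ˢ interior D.Ω → h p = 0) :
    ∫ p in Icc D.a T ×ˢ D.Ω, D.momT x z p * D.capT h p
      = ∫ p in Icc T D.b ×ˢ D.Ω,
          h p * (D.γ.2 * (D.leftMomT D.a x z p - D.leftMomT T x z p)) := by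
  have hTb := hA.mem.2
  have hsub : Icc D.a T ×ˢ D.Ω ⊆ D.P := Icc_prod_subset_P hTb
  have hss : Icc D.a T ⊆ Icc D.a D.b := Icc_subset_Icc_right hTb
  have hst : Icc T D.b ⊆ Icc D.a D.b := Icc_subset_Icc_left hA.mem.1
  have hcap := hD.capT_cont h hh.contDiffOn
  obtain ⟨hi, C, hb⟩ := hD.combKernelT
  have hl := hreg.left hγ
  have hlT := hreg.left_T hγ
  rw [setIntegral_prod_symm_of_continuousOn (F := fun p => D.momT x z p * D.capT h p)
      isCompact_Icc isCompact_Ω (((hD.continuousOn_momT hA).mul hcap.2).mono hsub),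
    setIntegral_prod_symm_of_continuousOn
      (F := fun p => h p * (D.γ.2 * (D.leftMomT D.a x z p - D.leftMomT T x z p)))
      isCompact_Icc isCompact_Ω (hh.continuous.continuousOn.mul (continuousOn_const.mul
        ((hl.2.mono (prod_mono hst subset_rfl)).sub hlT.2)))]
  refine setIntegral_congr_fun measurableSet_Ω fun s hs => ?_
  have hsec : ∀ A : Set ℝ, ContinuousOn (fun τ : ℝ => (τ, s)) A := fun A => by fun_prop
  have hout : ∀ t, t ∉ Ioo T D.b → h (t, s) = 0 := fun t ht => h0 _ fun hm => ht hm.1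
  have hlc : ContinuousOn (fun t => D.leftMomT D.a x z (t, s)) (Icc T D.b) :=
    hl.2.comp (hsec _) fun t ht => ⟨hst ht, hs⟩
  have hlTc : ContinuousOn (fun t => D.leftMomT T x z (t, s)) (Icc T D.b) :=
    hlT.2.comp (hsec _) fun t ht => ⟨ht, hs⟩
  have key : ∫ t in Icc D.a T, D.momT x z (t, s) * ∫ τ in Icc T D.b,
      combKernel D.α D.β D.γ t τ * deriv (fun τ => h (τ, s)) τ
      = ∫ t in Icc T D.b, h (t, s) * (D.γ.2 * (D.leftMomT D.a x z (t, s)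
        - D.leftMomT T x z (t, s))) :=
    integral_mul_combKernel_deriv_tail (γ := D.γ)
    (f := fun τ => D.momT x z (τ, s))
    (h := fun τ => h (τ, s)) hA.mem.1 hTb hD.α_meas hD.β_meas
    (fun t ht => (hi t (hss ht)).mono_set hst)
    (fun t ht => setIntegral_abs_mono hst (hi t (hss ht)) (hb t (hss ht)))
    ((hD.continuousOn_momT hA).comp (hsec _) fun t ht => ⟨hss ht, hs⟩)
    (contDiff_sectionT hh s) (hout _ fun hm => lt_irrefl _ hm.1)
    (hout _ fun hm => lt_irrefl _ hm.2) (hl.1 s hs) (hlT.1 s hs)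
    hlc hlTc
  refine Eq.trans (setIntegral_congr_fun measurableSet_Icc fun t ht => ?_) key
  congr 1
  have ht' : (t, s) ∈ D.P := ⟨hss ht, hs⟩
  rw [capT, combinedCaputo_eq ht'.1 (hcap.1 _ ht')]
  -- The derivative of `h` vanishes before `T`, so only the kernel over `[a, T] × [T, b]` matters.
  refine (setIntegral_eq_of_subset_of_forall_sdiff_eq_zero measurableSet_Icc hst
    fun τ hτ => ?_)
  have hτT : τ ∈ Iio T := lt_of_not_ge fun hle => hτ.2 ⟨hle, hτ.1.2⟩
  rw [deriv_eq_zero_of_eqOn_zero isOpen_Iio (fun r hr => hout r fun hm => hm.1.not_gt hr) hτT,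
    mul_zero]

/-- Fractional integration by parts in `sᵢ`. -/
theorem Standing.integral_momS_mul_capS (hD : D.Standing) (hA : D.Admissible x z T)
    (hreg : D.Regular x z T) (i : Fin n) (hh : ContDiff ℝ 1 h)
    (h0 : ∀ p, p ∉ Ioo D.a T ×ˢ interior D.Ω → h p = 0) :
    ∫ p in Icc D.a T ×ˢ D.Ω, D.momS i x z p * D.capS i h p
      = ∫ p in Icc D.a T ×ˢ D.Ω, h p * D.dualMomS i x z p := by
  have hsub : Icc D.a T ×ˢ D.Ω ⊆ D.P := Icc_prod_subset_P hA.mem.2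
  have hcap := hD.capS_cont i h hh.contDiffOn
  obtain ⟨hi, C, hb⟩ := hD.combKernelS i
  have c1 : ContinuousOn (fun p => D.momS i x z p * D.capS i h p) (Icc D.a T ×ˢ D.Ω) :=
    ((hD.continuousOn_momS hA i).mul hcap.2).mono hsub
  have c2 : ContinuousOn (fun p => h p * D.dualMomS i x z p) (Icc D.a T ×ˢ D.Ω) :=
    (hh.continuous.continuousOn (s := Icc D.a T ×ˢ D.Ω)).mul (hreg.dualS i)
  rw [setIntegral_prod_of_continuousOn isCompact_Icc isCompact_Ω c1,
    setIntegral_prod_of_continuousOn isCompact_Icc isCompact_Ω c2]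
  refine setIntegral_congr_fun measurableSet_Icc fun t ht => ?_
  have hsec : ContinuousOn (fun s : Fin n → ℝ => (t, s)) D.Ω := by fun_prop
  have hm : MapsTo (fun s : Fin n → ℝ => (t, s)) D.Ω (Icc D.a T ×ˢ D.Ω) := fun s hs => ⟨ht, hs⟩
  refine setIntegral_Icc_congr_of_lines hD.lo_le_hi i (c1.comp hsec hm) (c2.comp hsec hm)
    fun s hs => ?_
  have hline : ContinuousOn (fun σ : ℝ => (t, Function.update s i σ)) (Icc (D.lo i) (D.hi i)) :=
    (Continuous.prodMk continuous_const
      (Continuous.update (continuous_const (y := s)) i continuous_id)).continuousOn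
  have hml : ∀ σ ∈ Icc (D.lo i) (D.hi i), (t, Function.update s i σ) ∈ Icc D.a T ×ˢ D.Ω :=
    fun σ hσ => ⟨ht, update_mem_Ω hs hσ⟩
  have hout : ∀ σ, σ ∉ Ioo (D.lo i) (D.hi i) → h (t, Function.update s i σ) = 0 := fun σ hσ => by
    refine h0 _ fun hp => hσ ?_
    have := hp.2
    rw [interior_Ω] at this
    simpa using this i (mem_univ i)
  have hdual : ∀ σ, D.dualMomS i x z (t, Function.update s i σ)
      = dualRL (D.βs i) (D.αs i) (D.γs i) (D.lo i) (D.hi i)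
        (fun σ => D.momS i x z (t, Function.update s i σ)) σ := fun σ => by
    simp [dualMomS]
  have key := integral_mul_combKernel_deriv (γ := D.γs i)
    (f := fun σ => D.momS i x z (t, Function.update s i σ))
    (h := fun σ => h (t, Function.update s i σ)) (hD.lo_lt_hi i).le (hD.αs_meas i) (hD.βs_meas i)
    hi hb ((hD.continuousOn_momS hA i).comp hline fun σ hσ => hsub (hml σ hσ))
    (contDiff_sectionS hh t s i) (hout _ fun hm => lt_irrefl _ hm.1)
    (hout _ fun hm => lt_irrefl _ hm.2) (fun hγ => hreg.rightS i hγ (t, s) ⟨ht, hs⟩)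
    (fun hγ => hreg.leftS i hγ (t, s) ⟨ht, hs⟩)
    (((hreg.dualS i).comp hline hml).congr fun σ _ => (hdual σ).symm)
  simp only [hdual]
  refine Eq.trans (setIntegral_congr_fun measurableSet_Icc fun σ hσ => ?_) key
  congr 1
  have hex : CombinedCaputoExists (D.αs i) (D.βs i) (D.γs i) (D.lo i) (D.hi i)
      (fun σ => h (t, Function.update s i σ)) σ := by
    simpa using hcap.1 _ (hsub (hml σ hσ))
  rw [← combinedCaputo_eq hσ hex]
  simp [capS]

theorem Standing.euler_lagrange (hD : D.Standing) (hT : D.a < T) (hext : D.IsExtremizer x z T)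
    (hreg : D.Regular x z T) : ∀ p ∈ Icc D.a T ×ˢ D.Ω,
      partialX D.L (D.arg x z p) * D.mult x z p.1 + D.dualMomT T x z p
        + ∑ i, D.dualMomS i x z p = 0 := by
  have hA := hext.1
  have hc : IsCompact (Icc D.a T ×ˢ D.Ω) := isCompact_Icc.prod isCompact_Ω
  have c1 := (hD.continuousOn_momX hA).mono (Icc_prod_subset_P hA.mem.2)
  refine hD.eq_zero_of_forall_variation hT ((c1.add hreg.dual).add
    (continuousOn_finsetSum _ fun i _ => hreg.dualS i)) fun h hh h0 => ?_
  have hhc := hh.continuous.continuousOn (s := Icc D.a T ×ˢ D.Ω)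
  have hfv := hD.first_variation_prod hext hh.contDiffOn (eq_zero_on_frontier le_rfl hA.mem.2 h0)
  rw [hD.integral_momT_mul_capT hA hT hreg hh h0,
    Finset.sum_congr rfl fun i _ => hD.integral_momS_mul_capS hA hreg i hh h0] at hfv
  simp_rw [mul_add, Finset.mul_sum]
  exact (setIntegral_add_add_sum hc (hhc.mul c1) (hhc.mul hreg.dual)
    fun i => hhc.mul (hreg.dualS i)).trans hfv

/-- Up to time `T` such a variation vanishes along with its derivatives in `sᵢ`. In the first
variation only the Caputo derivative in `t` survives, through its right-sided part. -/
theorem Standing.euler_lagrange_tail (hD : D.Standing) (hTb : T < D.b)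
    (hext : D.IsExtremizer x z T) (hreg : D.Regular x z T) :
    ∀ p ∈ Icc T D.b ×ˢ D.Ω, D.γ.2 * (D.leftMomT D.a x z p - D.leftMomT T x z p) = 0 := by
  have hA := hext.1
  by_cases hγ : D.γ.2 = 0
  · simp [hγ]
  refine hD.eq_zero_of_forall_variation hTb (continuousOn_const.mul
    (((hreg.left hγ).2.mono (prod_mono (Icc_subset_Icc_left hA.mem.1) subset_rfl)).sub
      (hreg.left_T hγ).2)) fun h hh h0 => ?_
  have hfv := hD.first_variation_prod hext hh.contDiffOn (eq_zero_on_frontier hA.mem.1 le_rfl h0)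
  have hz : ∀ p ∈ Icc D.a T ×ˢ D.Ω, ∀ s, h (p.1, s) = 0 := fun p hp s =>
    h0 _ fun hm => hm.1.1.not_ge hp.1.2
  have hm : MeasurableSet (Icc D.a T ×ˢ D.Ω) := measurableSet_Icc.prod measurableSet_Ω
  have hcap : ∀ i, ∀ p ∈ Icc D.a T ×ˢ D.Ω, D.momS i x z p * D.capS i h p = 0 := fun i p hp => by
    simp [capS, hz p hp, combinedCaputo, leftCaputo, rightCaputo, leftInt, rightInt, leftKernel,
      rightKernel]
  rw [setIntegral_eq_zero_of_forall_eq_zero fun p hp => by rw [hz p hp p.2, zero_mul],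
    Finset.sum_eq_zero fun i _ => setIntegral_eq_zero_of_forall_eq_zero (hcap i),
    zero_add, add_zero] at hfv
  rw [← hD.integral_momT_mul_capT_tail hA hreg hγ hh h0]
  exact hfv

end Data
end Herglotz

theorem mainTheorem2 (n : ℕ) (D : Herglotz.Data n) (hD : D.Standing)
    (x : ℝ × (Fin n → ℝ) → ℝ) (z : ℝ → ℝ) (T : ℝ) (hT : D.a < T)
    (hext : D.IsExtremizer x z T) (hreg : D.Regular x z T) :
    (∀ t ∈ Icc D.a T, ∀ s ∈ D.Ω,
      Herglotz.partialX D.L (D.arg x z (t, s)) * D.mult x z t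
        + Herglotz.dualRL D.β D.α D.γ D.a T (fun τ => D.momT x z (τ, s)) t
        + ∑ i, Herglotz.dualRL (D.βs i) (D.αs i) (D.γs i) (D.lo i) (D.hi i)
            (fun σ => D.momS i x z (t, Function.update s i σ)) (s i) = 0) ∧
    (T < D.b → ∀ t ∈ Icc T D.b, ∀ s ∈ D.Ω,
      D.γ.2 * (Herglotz.leftRL D.β D.a D.b (fun τ => D.momT x z (τ, s)) t
        - Herglotz.leftRL D.β T D.b (fun τ => D.momT x z (τ, s)) t) = 0) ∧
    (∀ s ∈ D.Ω,
      D.γ.1 * Herglotz.rightInt (Herglotz.compl D.α) T (fun τ => D.momT x z (τ, s)) T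
        - D.γ.2 * Herglotz.leftInt (Herglotz.compl D.β) T (fun τ => D.momT x z (τ, s)) T = 0) ∧
    (T < D.b → (∫ s in D.Ω, D.L (D.arg x z (T, s))) = 0) :=
  ⟨fun t ht s hs => hD.euler_lagrange hT hext hreg (t, s) ⟨ht, hs⟩,
    fun hTb t ht s hs => hD.euler_lagrange_tail hTb hext hreg (t, s) ⟨ht, hs⟩,
    -- Both integrals run from `T` to `T`.
    fun s _ => by simp [Herglotz.rightInt, Herglotz.leftInt],
    fun hTb => hext.integral_L_eq_zero hT hTb⟩
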